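/- Let $\mathcal H=L^2([0,1])$ (real) and, for $x,y\in\mathcal H$, let $x\otimes y$ be the operator $z\mapsto\langle x,z\rangle y$; $\|\cdot\|$ is the operator norm. Let $(X,Y)$ be a random element of $\mathcal H\times\mathbb R^q$ with $\mathbb E\|X\|^2+\mathbb E\|Y\|^2<\infty$ and $\mathbb E X=0$. Let $(\phi_j)_{j\ge1}$ be an orthonormal basis of $\mathcal H$ consisting of eigenfunctions of the covariance operator $\mathrm{var}(X)=\mathbb E[(X-\mathbb EX)\otimes(X-\mathbb EX)]$, with eigenvalues in descending order, and suppose that the coverage condition $\operatorname{rank}\,\mathrm{var}(\mathbb E[X\mid Y])\le d$ holds for an integer $d\ge0$. Suppose that for some $\sigma_0,\sigma_1>0$ $$\sup_{j\ge1}\mathbb E\big[\exp(2\sigma_0\langle X,\phi_j\rangle^2)\big]\le\sigma_1,\qquad \mathbb E\big[\exp(2\sigma_0\|Y\|^2)\big]\le\sigma_1 .$$ For a random element $Z$ of $\mathcal H$ with $\mathbb E\|Z\|^2<\infty$ put $$\mathrm{MDDO}(Z\mid Y)=\frac1{c_q}\int_{\mathbb R^q}\frac{G_s\otimes\overline{G_s}}{\|s\|^{1+q}}\,ds,\qquad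 G_s=\mathrm{cov}\big(Z,e^{i\langle s,Y\rangle}\big),\qquad c_q=\frac{\pi^{(q+1)/2}}{\Gamma((q+1)/2)},$$ the integral being the limit as $\varepsilon\to0^+$ of the integrals over $\varepsilon\le\|s\|\le\varepsilon^{-1}$. For $m\ge1$ let $\Pi_m=\sum_{i=1}^m\phi_i\otimes\phi_i$ and $M_m=\mathrm{MDDO}(\Pi_mX\mid Y)$. For i.i.d. copies $(X_1,Y_1),\dots,(X_n,Y_n)$ of $(X,Y)$ let $$\widehat M_m=-\frac1{n^2}\sum_{j,k=1}^n\|Y_j-Y_k\|\,\Pi_mX_j\otimes\Pi_mX_k,\qquad \widehat M_m^d=\sum_{i=1}^d\widehat\mu_i\,\widehat\gamma_i\otimes\widehat\gamma_i,$$ where $\widehat\mu_1\ge\dots\ge\widehat\mu_d$ are the $d$ largest eigenvalues of $\widehat M_m$, counted with multiplicity, and $\widehat\gamma_1,\dots,\widehat\gamma_d$ are corresponding orthonormal eigenfunctions (such eigenfunctions exist). **Proposition.** For every $\gamma\in(0,1/2)$ there are positive constants $D_0=D_0(\gamma,\sigma_0,\sigma_1)$, $D_1=D_1(\sigma_1)$,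 $D_2=D_2(\sigma_0,\sigma_1)$ and a positive integer $n_0=n_0(\gamma,\sigma_0,\sigma_1)$, depending on nothing else, such that for all $n\ge n_0$, all integers $m\ge1$ and all $$C\in\Big(D_0n^{2\gamma/5}-\ln(D_1m^2n),\ D_2n^{1/5}-\ln(D_1m^2n)\Big],$$ with probability at least $1-e^{-C}$ one has, for every choice of the $\widehat\gamma_i$ (in case of ties), $$\big\|\widehat M_m^d-M_m\big\|<\Big(\frac{C+\ln(D_1m^2n)}{D_2}\Big)^{5/2}\,\frac{24m}{\sqrt n}.$$ -/

import Mathlib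

open MeasureTheory ProbabilityTheory Filter Topology InnerProductSpace

noncomputable section

namespace FSFIR

/-- The real Hilbert space `L²([0,1])`. -/
abbrev L2I : Type := Lp ℝ 2 (volume.restrict (Set.Icc (0 : ℝ) 1))

instance : MeasurableSpace L2I := borel L2I

instance : BorelSpace L2I := ⟨rfl⟩

section Operators

variable {H : Type*} [NormedAddCommGroup H] [InnerProductSpace ℝ H]

/-- The tensor product `x ⊗ y`, i.e. the operator `z ↦ ⟨x, z⟩ y`. -/
def tensor (x y : H) : H →L[ℝ] H := rankOne ℝ y x

/-- The operator `Π_m = ∑_{i < m} φ_i ⊗ φ_i` (the sequence `φ` is indexed from `0`). -/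
def truncProj (φ : ℕ → H) (m : ℕ) : H →L[ℝ] H :=
  ∑ i ∈ Finset.range m, tensor (φ i) (φ i)

/-- `S = ∑_{i < d} μ_i γ_i ⊗ γ_i` where `γ_0, …, γ_{d-1}` are orthonormal eigenvectors of the
operator `T` for its `d` largest eigenvalues `μ_0 ≥ … ≥ μ_{d-1}`, counted with multiplicity: on
the orthogonal complement of the `γ_i` the quadratic form of `T` is at most each `μ_i`.
If there are ties, several `S` are possible. -/
def IsTopEigenPart (d : ℕ) (T S : H →L[ℝ] H) : Prop :=
  ∃ (μ : Fin d → ℝ) (γ : Fin d → H),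
    Antitone μ ∧ Orthonormal ℝ γ ∧ (∀ i, T (γ i) = μ i • γ i) ∧
    (∀ x : H, (∀ i, inner ℝ (γ i) x = 0) → ∀ i, inner ℝ (T x) x ≤ μ i * ‖x‖ ^ 2) ∧
    S = ∑ i, μ i • tensor (γ i) (γ i)

/-- The sample operator `-(1/n²) ∑_{j,k} ‖y_j - y_k‖ x_j ⊗ x_k`. -/
def sampleMDDO {E : Type*} [NormedAddCommGroup E] {n : ℕ} (x : Fin n → H) (y : Fin n → E) :
    H →L[ℝ] H :=
  -((1 / (n : ℝ) ^ 2) • ∑ j, ∑ k, ‖y j - y k‖ • tensor (x j) (x k))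

end Operators

section Random

variable {Ω : Type*} [MeasurableSpace Ω]
variable {H : Type*} [NormedAddCommGroup H] [InnerProductSpace ℝ H]

/-- The covariance operator `var(X) = E[(X - E X) ⊗ (X - E X)]`. -/
def covOp (P : Measure Ω) (X : Ω → H) : H →L[ℝ] H :=
  ∫ ω, tensor (X ω - ∫ ω', X ω' ∂P) (X ω - ∫ ω', X ω' ∂P) ∂P

/-- Real part of `G_s = cov(X, exp(i⟨s, Y⟩))`. -/
def gRe {q : ℕ} (P : Measure Ω) (X : Ω → H) (Y : Ω → EuclideanSpace ℝ (Fin q))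
    (s : EuclideanSpace ℝ (Fin q)) : H :=
  (∫ ω, Real.cos (inner ℝ s (Y ω)) • X ω ∂P) -
    (∫ ω, Real.cos (inner ℝ s (Y ω)) ∂P) • ∫ ω, X ω ∂P

/-- Imaginary part of `G_s = cov(X, exp(i⟨s, Y⟩))`. -/
def gIm {q : ℕ} (P : Measure Ω) (X : Ω → H) (Y : Ω → EuclideanSpace ℝ (Fin q))
    (s : EuclideanSpace ℝ (Fin q)) : H :=
  (∫ ω, Real.sin (inner ℝ s (Y ω)) • X ω ∂P) -
    (∫ ω, Real.sin (inner ℝ s (Y ω)) ∂P) • ∫ ω, X ω ∂P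

/-- The complex number `⟨G_s, α⟩ = cov(⟨X, α⟩, exp(i⟨s, Y⟩))`, for `α` in the real space `H`. -/
def gPair {q : ℕ} (P : Measure Ω) (X : Ω → H) (Y : Ω → EuclideanSpace ℝ (Fin q))
    (s : EuclideanSpace ℝ (Fin q)) (α : H) : ℂ :=
  (inner ℝ (gRe P X Y s) α : ℝ) + (inner ℝ (gIm P X Y s) α : ℝ) * Complex.I

/-- The constant `c_q = π^{(q+1)/2} / Γ((q+1)/2)`. -/
def mddConst (q : ℕ) : ℝ :=
  Real.pi ^ (((q : ℝ) + 1) / 2) / Real.Gamma (((q : ℝ) + 1) / 2)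

/-- `T = (1/c_q) ∫ (G_s ⊗ conj G_s) / ‖s‖^{1+q} ds`, the integral over `ℝ^q` being a principal
value (limit of the integrals over `ε ≤ ‖s‖ ≤ 1/ε`), and operators being integrated through their
matrix elements: `⟨(G_s ⊗ conj G_s) α, β⟩ = ⟨G_s, α⟩ conj ⟨G_s, β⟩` for `α, β` in `H`. -/
def IsMDDO {q : ℕ} (P : Measure Ω) (X : Ω → H) (Y : Ω → EuclideanSpace ℝ (Fin q))
    (T : H →L[ℝ] H) : Prop :=
  ∀ α β : H, Tendsto
    (fun ε : ℝ => ((1 / mddConst q : ℝ) : ℂ) *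
      ∫ s in {s : EuclideanSpace ℝ (Fin q) | ε ≤ ‖s‖ ∧ ‖s‖ ≤ ε⁻¹},
        gPair P X Y s α * (starRingEnd ℂ) (gPair P X Y s β) / ((‖s‖ ^ (1 + q) : ℝ) : ℂ))
    (𝓝[>] 0) (𝓝 ((inner ℝ (T α) β : ℝ) : ℂ))

theorem IsMDDO.unique {q : ℕ} {P : Measure Ω} {X : Ω → H} {Y : Ω → EuclideanSpace ℝ (Fin q)}
    {T T' : H →L[ℝ] H} (h : IsMDDO P X Y T) (h' : IsMDDO P X Y T') : T = T' := by
  ext1 α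
  refine ext_inner_right ℝ fun β => ?_
  exact_mod_cast tendsto_nhds_unique (h α β) (h' α β)

open Classical in
/-- The martingale difference divergence operator `MDDO(X | Y)`; it is `0` by convention if the
defining integral does not exist as a bounded operator. -/
def mddo {q : ℕ} (P : Measure Ω) (X : Ω → H) (Y : Ω → EuclideanSpace ℝ (Fin q)) : H →L[ℝ] H :=
  if h : ∃ T, IsMDDO P X Y T then h.choose else 0

end Random

end FSFIR

end

noncomputable section

namespace FSFIR

/-! ### Finite-rank operators in coordinates and their top eigenparts -/

section Operators

variable {H : Type*} [NormedAddCommGroup H] [InnerProductSpace ℝ H]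

/-! Write `T` for the sample operator, `M` for `MDDO(Π_m X | Y)` and `S` for a top part of `T` with
`d` eigenpairs. The argument splits into a deterministic reduction, an identification of `M`, and a
concentration bound for single matrix entries.

Reduction. If `M` is positive semidefinite of rank at most `d`, then a Weyl-type argument gives `‖T
- S‖ ≤ ‖T - M‖`, hence `‖S - M‖ ≤ 2‖T - M‖` (`IsTopEigenPart.norm_sub_le`). Both `T` and `M` live on
the span of the first `m` basis vectors, so `‖T - M‖` is at most `m` times the largest entry of
their difference (`norm_coordOp_le`).

Identification. The integral of `(1 - cos⟨s, x⟩) / ‖s‖^(1+q)` over `s` is `c_q ‖x‖`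
(`lintegral_one_sub_cos_div_norm_pow`). For a centred predictor this turns the principal value
defining `M` into entries `-E ‖Y - Y'‖ ⟨X, φ_a⟩⟨X', φ_b⟩`, with `(X', Y')` an independent copy
(`mddo_truncProj`). The principal value form is kept as well: it shows that the quadratic form of
`M` is nonnegative, and that `M α = 0` whenever `var(E[X | Y])` kills `Π_m α`, so the coverage
condition bounds the rank of `M`.

Concentration. An entry of `T` is, up to sign, the V-statistic `n⁻² ∑ ‖Y_j - Y_k‖ a_j b_k`. For
fixed `k` the sum over `j ≠ k`, centred given the `k`-th point and divided by `1 + ‖Y_k‖`, has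
i.i.d. summands whose exponential moments are bounded uniformly in that point; Chernoff at scale
`1/√n` makes it `O(L √n)` outside probability `2 exp(-L)`. The weights `b_k (1 + ‖Y_k‖)` are `O(L)`
by Markov, and the sum of conditional means is again i.i.d. Hence each entry deviates by at most a
constant times `L² / √n` outside probability `(4 + σ₁) n exp(-L)`
(`measure_pi_abs_vStat_sub_gt_le`). A union bound over `m²` entries with `L = C + ln(D₁ m² n)`, `D₁
= 4 + σ₁`, leaves failure probability `exp(-C)`. The power `L²` is then relaxed to `(L / D₂)^(5/2)`.
-/

theorem tensor_apply (x y z : H) : tensor x y z = inner ℝ x z • y := by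
  simp [tensor]

/-- The operator `-∑_{a, b < m} A a b φ_a ⊗ φ_b`. -/
def coordOp (φ : ℕ → H) (m : ℕ) (A : ℕ → ℕ → ℝ) : H →L[ℝ] H :=
  -∑ a ∈ Finset.range m, ∑ b ∈ Finset.range m, A a b • tensor (φ a) (φ b)

theorem coordOp_apply (φ : ℕ → H) (m : ℕ) (A : ℕ → ℕ → ℝ) (z : H) :
    coordOp φ m A z =
      -∑ b ∈ Finset.range m, (∑ a ∈ Finset.range m, A a b * inner ℝ (φ a) z) • φ b := by
  simp only [coordOp, neg_apply, sum_apply,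
    smul_apply, tensor_apply, Finset.sum_smul, smul_smul]
  rw [Finset.sum_comm]

theorem inner_coordOp (φ : ℕ → H) (m : ℕ) (A : ℕ → ℕ → ℝ) (x y : H) :
    inner ℝ (coordOp φ m A x) y =
      -∑ a ∈ Finset.range m, ∑ b ∈ Finset.range m,
        A a b * (inner ℝ (φ a) x * inner ℝ (φ b) y) := by
  simp only [coordOp_apply, inner_neg_left, sum_inner, real_inner_smul_left, Finset.sum_mul]
  rw [Finset.sum_comm]
  simp only [mul_assoc]

theorem coordOp_sub (φ : ℕ → H) (m : ℕ) (A B : ℕ → ℕ → ℝ) :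
    coordOp φ m A - coordOp φ m B = coordOp φ m (fun a b => A a b - B a b) := by
  ext1 z
  refine ext_inner_right ℝ fun y => ?_
  simp only [sub_apply, inner_sub_left, inner_coordOp, sub_mul,
    Finset.sum_sub_distrib]
  ring

theorem coordOp_isSymmetric (φ : ℕ → H) (m : ℕ) {A : ℕ → ℕ → ℝ} (hA : ∀ a b, A a b = A b a) :
    (coordOp φ m A).IsSymmetric := by
  intro x y
  change inner ℝ (coordOp φ m A x) y = inner ℝ x (coordOp φ m A y)
  rw [real_inner_comm _ x, inner_coordOp, inner_coordOp, Finset.sum_comm]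
  congr 1
  refine Finset.sum_congr rfl fun a _ => Finset.sum_congr rfl fun b _ => ?_
  rw [hA a b]
  ring

/-- The Hilbert–Schmidt norm of an `m × m` matrix with entries at most `ε` is at most `m ε`:
Cauchy–Schwarz in each output coordinate, then Bessel for the coordinates of `z`. -/
theorem norm_coordOp_le {φ : ℕ → H} (hφ : Orthonormal ℝ φ) (m : ℕ) {A : ℕ → ℕ → ℝ} {ε : ℝ}
    (hε : 0 ≤ ε) (hA : ∀ a < m, ∀ b < m, |A a b| ≤ ε) : ‖coordOp φ m A‖ ≤ m * ε := by
  refine ContinuousLinearMap.opNorm_le_bound _ (by positivity) fun z => ?_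
  rw [coordOp_apply, norm_neg]
  refine abs_le_of_sq_le_sq' ?_ (by positivity) |>.2
  rw [← real_inner_self_eq_norm_sq, hφ.inner_sum]
  have hB : ∑ a ∈ Finset.range m, inner ℝ (φ a) z ^ 2 ≤ ‖z‖ ^ 2 := by
    simpa using hφ.sum_inner_products_le z (s := Finset.range m)
  calc ∑ b ∈ Finset.range m, (∑ a ∈ Finset.range m, A a b * inner ℝ (φ a) z) *
          (∑ a ∈ Finset.range m, A a b * inner ℝ (φ a) z)
      ≤ ∑ b ∈ Finset.range m, (m * ε ^ 2) * ‖z‖ ^ 2 := by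
        refine Finset.sum_le_sum fun b hb => ?_
        rw [← sq]
        refine (Finset.sum_mul_sq_le_sq_mul_sq _ _ _).trans ?_
        refine mul_le_mul ?_ hB (by positivity) (by positivity)
        calc ∑ a ∈ Finset.range m, A a b ^ 2 ≤ ∑ a ∈ Finset.range m, ε ^ 2 := by
              refine Finset.sum_le_sum fun a ha => sq_le_sq' ?_ ?_
              · exact (abs_le.1 (hA a (Finset.mem_range.1 ha) b (Finset.mem_range.1 hb))).1
              · exact (abs_le.1 (hA a (Finset.mem_range.1 ha) b (Finset.mem_range.1 hb))).2
          _ = m * ε ^ 2 := by simp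
    _ = (m * ε * ‖z‖) ^ 2 := by simp; ring

theorem truncProj_apply (φ : ℕ → H) (m : ℕ) (z : H) :
    truncProj φ m z = ∑ a ∈ Finset.range m, inner ℝ (φ a) z • φ a := by
  simp [truncProj, tensor_apply]

theorem inner_truncProj (φ : ℕ → H) (m : ℕ) (x y : H) :
    inner ℝ (truncProj φ m x) y =
      ∑ a ∈ Finset.range m, inner ℝ x (φ a) * inner ℝ (φ a) y := by
  simp_rw [truncProj_apply, sum_inner, real_inner_smul_left, real_inner_comm x]

theorem inner_truncProj_comm (φ : ℕ → H) (m : ℕ) (x y : H) :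
    inner ℝ (truncProj φ m x) y = inner ℝ x (truncProj φ m y) := by
  rw [real_inner_comm _ x, inner_truncProj, inner_truncProj]
  refine Finset.sum_congr rfl fun a _ => ?_
  rw [real_inner_comm y, real_inner_comm _ x, mul_comm]

theorem _root_.Finset.sum_comm₄ {ι κ M : Type*} [AddCommMonoid M] (s : Finset ι) (t : Finset κ)
    (f : ι → ι → κ → κ → M) :
    ∑ i ∈ s, ∑ j ∈ s, ∑ k ∈ t, ∑ l ∈ t, f i j k l =
      ∑ k ∈ t, ∑ l ∈ t, ∑ i ∈ s, ∑ j ∈ s, f i j k l := by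
  have h : ∀ i, ∑ j ∈ s, ∑ k ∈ t, ∑ l ∈ t, f i j k l =
      ∑ k ∈ t, ∑ l ∈ t, ∑ j ∈ s, f i j k l := fun i => by
    rw [Finset.sum_comm]
    exact Finset.sum_congr rfl fun k _ => Finset.sum_comm
  simp_rw [h]
  rw [Finset.sum_comm]
  exact Finset.sum_congr rfl fun k _ => Finset.sum_comm

theorem sampleMDDO_truncProj {E : Type*} [NormedAddCommGroup E] {n : ℕ} (φ : ℕ → H) (m : ℕ)
    (x : Fin n → H) (y : Fin n → E) :
    sampleMDDO (fun k => truncProj φ m (x k)) y =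
      coordOp φ m (fun a b => (1 / (n : ℝ) ^ 2) *
        ∑ j, ∑ k, ‖y j - y k‖ * (inner ℝ (x j) (φ a) * inner ℝ (x k) (φ b))) := by
  ext1 u
  refine ext_inner_right ℝ fun v => ?_
  rw [inner_coordOp]
  simp only [sampleMDDO, neg_apply, sum_apply,
    smul_apply, tensor_apply, inner_neg_left, sum_inner,
    real_inner_smul_left]
  congr 1
  have h1 : ∀ j, inner ℝ (truncProj φ m (x j)) u =
      ∑ a ∈ Finset.range m, inner ℝ (x j) (φ a) * inner ℝ (φ a) u :=
    fun j => inner_truncProj φ m (x j) u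
  have h2 : ∀ j, inner ℝ (truncProj φ m (x j)) v =
      ∑ a ∈ Finset.range m, inner ℝ (x j) (φ a) * inner ℝ (φ a) v :=
    fun j => inner_truncProj φ m (x j) v
  simp only [h1, h2, Finset.sum_mul_sum]
  simp only [Finset.mul_sum, Finset.sum_mul]
  rw [Finset.sum_comm₄]
  refine Finset.sum_congr rfl fun a _ => Finset.sum_congr rfl fun b _ =>
    Finset.sum_congr rfl fun j _ => Finset.sum_congr rfl fun k _ => ?_
  ring

theorem norm_le_of_abs_inner_le {T : H →L[ℝ] H} (hT : T.IsSymmetric) {ε : ℝ} (hε : 0 ≤ ε)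
    (h : ∀ x, |inner ℝ (T x) x| ≤ ε * ‖x‖ ^ 2) : ‖T‖ ≤ ε := by
  rw [ContinuousLinearMap.norm_eq_iSup_rayleighQuotient T hT]
  refine ciSup_le fun x => ?_
  rw [ContinuousLinearMap.rayleighQuotient, ContinuousLinearMap.reApplyInnerSelf_apply]
  simp only [RCLike.re_to_real, abs_div, abs_pow, abs_norm]
  exact div_le_of_le_mul₀ (by positivity) hε (h x)

/-- The spectral theorem applies on a finite-dimensional invariant subspace containing the range.
Off that subspace the quadratic form of `T` vanishes, so the maximality condition on all of `H`
needs the selected eigenvalues to be nonnegative. -/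
theorem exists_isTopEigenPart {φ : ℕ → H} (hφ : Orthonormal ℝ φ) {m : ℕ} {T : H →L[ℝ] H}
    (hT : T.IsSymmetric)
    (hr : ∀ x, T x ∈ Submodule.span ℝ (Set.range fun i : Fin m => φ i)) (d : ℕ) :
    ∃ S, IsTopEigenPart d T S := by
  set U := Submodule.span ℝ (Set.range fun i : Fin m => φ i) with hU
  -- The `d` extra basis vectors leave room for `d` orthonormal eigenvectors even when `d > m`, and
  -- force enough zero eigenvalues.
  set V := Submodule.span ℝ (Set.range fun i : Fin (m + d) => φ i) with hV
  have hUV : U ≤ V := by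
    refine Submodule.span_mono ?_
    rintro _ ⟨i, rfl⟩
    exact ⟨Fin.castAdd d i, rfl⟩
  have hnV : Module.finrank ℝ V = m + d := by
    simpa [Function.comp_def] using finrank_span_eq_card
      (hφ.linearIndependent.comp (fun i : Fin (m + d) => (i : ℕ)) Fin.val_injective)
  have hnU : Module.finrank ℝ U = m := by
    simpa [Function.comp_def] using finrank_span_eq_card
      (hφ.linearIndependent.comp (fun i : Fin m => (i : ℕ)) Fin.val_injective)
  have : FiniteDimensional ℝ V := FiniteDimensional.span_of_finite ℝ (Set.finite_range _)
  have : FiniteDimensional ℝ U := FiniteDimensional.span_of_finite ℝ (Set.finite_range _)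
  have hTV : ∀ x ∈ V, T.toLinearMap x ∈ V := fun x _ => hUV (hr x)
  have hT' := LinearMap.IsSymmetric.restrict_invariant hT hTV
  set b := hT'.eigenvectorBasis hnV with hb
  set lam := hT'.eigenvalues hnV with hlam
  have hanti : Antitone lam := hT'.eigenvalues_antitone hnV
  have heig : ∀ j, T (b j : H) = lam j • (b j : H) := fun j => by
    have := congrArg (Subtype.val) (hT'.apply_eigenvectorBasis hnV j)
    exact this
  have hbo : Orthonormal ℝ (fun j => (b j : H)) :=
    b.orthonormal.comp_linearIsometry V.subtypeₗᵢ
  -- A negative eigenvalue at an index `j < d` would make the `m + 1` eigenvalues from `j` to `j +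
  -- m` negative; their eigenvectors would all lie in `U`, which has dimension `m`.
  have hnn : ∀ j : Fin (m + d), (j : ℕ) < d → 0 ≤ lam j := by
    intro j hj
    by_contra hneg
    push Not at hneg
    have hidx : ∀ k : Fin (m + 1), (j : ℕ) + k < m + d := fun k => by omega
    have hmem : ∀ k : Fin (m + 1), (b ⟨j + k, hidx k⟩ : H) ∈ U := fun k => by
      have hk : lam ⟨j + k, hidx k⟩ < 0 :=
        (hanti (show j ≤ ⟨j + k, hidx k⟩ from Fin.mk_le_mk.2 (by simp))).trans_lt hneg
      have := U.smul_mem (lam ⟨j + k, hidx k⟩)⁻¹ (hr (b ⟨j + k, hidx k⟩ : H))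
      rwa [heig, smul_smul, inv_mul_cancel₀ hk.ne, one_smul] at this
    have hli : LinearIndependent ℝ (fun k : Fin (m + 1) => (⟨_, hmem k⟩ : U)) := by
      refine LinearIndependent.of_comp U.subtype ?_
      refine hbo.linearIndependent.comp (fun k : Fin (m + 1) => ⟨j + k, hidx k⟩) ?_
      intro k l hkl
      simpa [Fin.ext_iff] using hkl
    have := hli.fintype_card_le_finrank
    rw [hnU] at this
    simp at this
  have hdm : d ≤ m + d := Nat.le_add_left d m
  refine ⟨∑ i, lam (Fin.castLE hdm i) •
      tensor (b (Fin.castLE hdm i) : H) (b (Fin.castLE hdm i) : H),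
    fun i => lam (Fin.castLE hdm i), fun i => (b (Fin.castLE hdm i) : H),
    fun i j hij => hanti ?_, hbo.comp _ (Fin.castLE_injective hdm), fun i => heig _, ?_, rfl⟩
  · simpa using hij
  · intro x hx i
    have h1 : T x = ∑ j, (lam j * inner ℝ (b j : H) x) • (b j : H) := by
      have := congrArg Subtype.val (b.sum_repr' ⟨T x, hUV (hr x)⟩)
      rw [← show ((⟨T x, hUV (hr x)⟩ : V) : H) = T x from rfl, ← this]
      simp only [Submodule.coe_sum, Submodule.coe_smul, Submodule.coe_inner]
      refine Finset.sum_congr rfl fun j _ => ?_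
      have h2 : inner ℝ (b j : H) (T x) = inner ℝ (T (b j : H)) x := (hT _ _).symm
      rw [h2, heig, real_inner_smul_left]
    rw [h1, sum_inner]
    have hBes : ∑ j, inner ℝ (b j : H) x ^ 2 ≤ ‖x‖ ^ 2 := by
      simpa using hbo.sum_inner_products_le x (s := Finset.univ)
    have hi0 := hnn (Fin.castLE hdm i) (by simp)
    refine le_trans ?_ (mul_le_mul_of_nonneg_left hBes hi0)
    rw [Finset.mul_sum]
    refine Finset.sum_le_sum fun j _ => ?_
    rw [real_inner_smul_left, mul_assoc, ← sq]
    by_cases hj : (j : ℕ) < d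
    · have : inner ℝ (b j : H) x = 0 := hx ⟨j, hj⟩
      simp [this]
    · refine mul_le_mul_of_nonneg_right (hanti ?_) (sq_nonneg _)
      rw [Fin.le_def]
      simp
      omega

/-- Weyl's argument. If the bound failed, every `μ i` would exceed `‖T - M‖` too, so the form of `T`
would exceed `‖T - M‖ ‖w‖²` at every nonzero `w` in the span of `x` and the `γ i`. This span has
dimension `d + 1`, so it meets the kernel of `M`, where `T` agrees with `T - M`. -/
theorem IsTopEigenPart.inner_apply_le {d : ℕ} {T M : H →L[ℝ] H} {μ : Fin d → ℝ} {γ : Fin d → H}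
    (hT : T.IsSymmetric) (hγ : Orthonormal ℝ γ) (he : ∀ i, T (γ i) = μ i • γ i)
    (hM : LinearMap.rank M.toLinearMap ≤ d) {x : H} (hx : ∀ i, inner ℝ (γ i) x = 0)
    (hμ : ∀ i, inner ℝ (T x) x ≤ μ i * ‖x‖ ^ 2) :
    inner ℝ (T x) x ≤ ‖T - M‖ * ‖x‖ ^ 2 := by
  by_contra! hlt
  have hx0 : 0 < ‖x‖ ^ 2 := by
    rcases eq_or_ne x 0 with rfl | h
    · simp at hlt
    · positivity
  have hμ' : ∀ i, ‖T - M‖ < μ i := fun i =>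
    lt_of_mul_lt_mul_right (hlt.trans_le (hμ i)) hx0.le
  have hfin : FiniteDimensional ℝ (LinearMap.range M.toLinearMap) :=
    Module.rank_lt_aleph0_iff.1 (hM.trans_lt (Cardinal.natCast_lt_aleph0))
  have hfr : Module.finrank ℝ (LinearMap.range M.toLinearMap) ≤ d :=
    Module.finrank_le_of_rank_le hM
  -- The index `none` carries `x` and `some i` carries `γ i`: there are `d + 1` images in a range of
  -- dimension at most `d`.
  have hdep : ¬ LinearIndependent ℝ (fun o : Option (Fin d) =>
      M.toLinearMap.rangeRestrict (o.elim x γ)) := fun h => by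
    have := h.fintype_card_le_finrank
    simp at this
    omega
  obtain ⟨c, hc, o, ho⟩ := Fintype.not_linearIndependent_iff.1 hdep
  rw [Fintype.sum_option] at hc
  set w := c none • x + ∑ i, c (some i) • γ i with hw
  have hMw : M w = 0 := by
    have := congrArg Subtype.val hc
    simpa [hw] using this
  have hs : ∀ f g : Fin d → ℝ, inner ℝ (∑ i, f i • γ i) (∑ i, g i • γ i) = ∑ i, f i * g i :=
    fun f g => by simpa using hγ.inner_sum f g Finset.univ
  have hTx : ∀ i, inner ℝ (T x) (γ i) = 0 := fun i => by
    have : inner ℝ (T x) (γ i) = inner ℝ x (T (γ i)) := hT _ _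
    rw [this, he, real_inner_smul_right, real_inner_comm, hx, mul_zero]
  have hTw : inner ℝ (T w) w =
      c none ^ 2 * inner ℝ (T x) x + ∑ i, μ i * c (some i) ^ 2 := by
    have h1 : T w = c none • T x + ∑ i, (c (some i) * μ i) • γ i := by
      simp [hw, he, smul_smul]
    rw [h1, hw, inner_add_left, inner_add_right, inner_add_right, hs]
    simp only [real_inner_smul_left, real_inner_smul_right, inner_sum, sum_inner, hTx, hx]
    simp only [mul_zero, Finset.sum_const_zero, add_zero, zero_add]
    congr 1
    · ring
    · exact Finset.sum_congr rfl fun i _ => by ring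
  have hww : ‖w‖ ^ 2 = c none ^ 2 * ‖x‖ ^ 2 + ∑ i, c (some i) ^ 2 := by
    have hx' : ∀ i, inner ℝ x (γ i) = 0 := fun i => by rw [real_inner_comm, hx]
    rw [← real_inner_self_eq_norm_sq, hw, inner_add_left, inner_add_right, inner_add_right, hs]
    simp only [real_inner_smul_left, real_inner_smul_right, inner_sum, sum_inner, hx', hx,
      real_inner_self_eq_norm_sq]
    simp only [mul_zero, Finset.sum_const_zero, add_zero, zero_add]
    congr 1
    · rw [norm_smul, mul_pow, Real.norm_eq_abs, sq_abs]
    · exact Finset.sum_congr rfl fun i _ => by ring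
  have hle : inner ℝ (T w) w ≤ ‖T - M‖ * ‖w‖ ^ 2 := by
    have h1 : T w = (T - M) w := by simp [hMw]
    rw [h1]
    calc _ ≤ ‖(T - M) w‖ * ‖w‖ := real_inner_le_norm _ _
      _ ≤ ‖T - M‖ * ‖w‖ * ‖w‖ := by gcongr; exact (T - M).le_opNorm w
      _ = _ := by ring
  have hsum : c none ^ 2 * (inner ℝ (T x) x - ‖T - M‖ * ‖x‖ ^ 2) +
      ∑ i, (μ i - ‖T - M‖) * c (some i) ^ 2 ≤ 0 := by
    rw [hTw, hww] at hle
    simp only [sub_mul, Finset.sum_sub_distrib, ← Finset.mul_sum]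
    linarith
  have hn : ∀ i, 0 ≤ (μ i - ‖T - M‖) * c (some i) ^ 2 := fun i =>
    mul_nonneg (sub_nonneg.2 (hμ' i).le) (sq_nonneg _)
  have hn0 : 0 ≤ c none ^ 2 * (inner ℝ (T x) x - ‖T - M‖ * ‖x‖ ^ 2) :=
    mul_nonneg (sq_nonneg _) (sub_nonneg.2 hlt.le)
  rcases o with _ | i
  · have : 0 < c none ^ 2 * (inner ℝ (T x) x - ‖T - M‖ * ‖x‖ ^ 2) :=
      mul_pos (by positivity) (sub_pos.2 hlt)
    linarith [Finset.sum_nonneg fun i (_ : i ∈ Finset.univ) => hn i]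
  · have : 0 < (μ i - ‖T - M‖) * c (some i) ^ 2 :=
      mul_pos (sub_pos.2 (hμ' i)) (by positivity)
    linarith [Finset.single_le_sum (fun i _ => hn i) (Finset.mem_univ i)]

/-- `T - S` acts as `T` on the orthogonal complement of the `γ i` and vanishes on their span. On the
complement the form of `T` is bounded above by the Weyl argument and below because `M ≥ 0`; the
triangle inequality then yields the factor 2. -/
theorem IsTopEigenPart.norm_sub_le {d : ℕ} {T S M : H →L[ℝ] H} (hS : IsTopEigenPart d T S)
    (hT : T.IsSymmetric) (hM : ∀ x, 0 ≤ inner ℝ (M x) x)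
    (hr : LinearMap.rank M.toLinearMap ≤ d) : ‖S - M‖ ≤ 2 * ‖T - M‖ := by
  obtain ⟨μ, γ, -, hγ, he, hμ, rfl⟩ := hS
  set S := ∑ i, μ i • tensor (γ i) (γ i) with hSdef
  have hSz : ∀ z, S z = ∑ i, (μ i * inner ℝ (γ i) z) • γ i := fun z => by
    simp [hSdef, tensor_apply, smul_smul]
  have hTS : ‖T - S‖ ≤ ‖T - M‖ := by
    refine norm_le_of_abs_inner_le ?_ (norm_nonneg _) fun z => ?_
    · intro x y
      change inner ℝ (T x - S x) y = inner ℝ x (T y - S y)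
      have h1 : inner ℝ (T x) y = inner ℝ x (T y) := hT x y
      rw [inner_sub_left, inner_sub_right, h1, hSz, hSz, sum_inner, inner_sum]
      congr 1
      refine Finset.sum_congr rfl fun i _ => ?_
      rw [real_inner_smul_left, real_inner_smul_right, real_inner_comm x]
      ring
    · set p := ∑ i, inner ℝ (γ i) z • γ i with hp
      set x := z - p with hxdef
      have hx : ∀ i, inner ℝ (γ i) x = 0 := fun i => by
        rw [hxdef, inner_sub_right, hp, hγ.inner_right_fintype, sub_self]
      have hTx : ∀ i, inner ℝ (T x) (γ i) = 0 := fun i => by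
        have : inner ℝ (T x) (γ i) = inner ℝ x (T (γ i)) := hT _ _
        rw [this, he, real_inner_smul_right, real_inner_comm, hx, mul_zero]
      have h1 : (T - S) z = T x := by
        simp [hxdef, hSz, hp, he, smul_smul, mul_comm]
      have h2 : inner ℝ (T x) z = inner ℝ (T x) x := by
        have : z = x + p := by simp [hxdef]
        conv_lhs => rw [this]
        rw [inner_add_right, hp, inner_sum]
        simp [real_inner_smul_right, hTx]
      have h3 : ‖x‖ ^ 2 ≤ ‖z‖ ^ 2 := by
        have h4 : inner ℝ x p = 0 := by
          rw [hp, inner_sum]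
          refine Finset.sum_eq_zero fun i _ => ?_
          rw [real_inner_smul_right, real_inner_comm (γ i) x, hx, mul_zero]
        have : z = x + p := by simp [hxdef]
        rw [this, norm_add_sq_real, h4]
        nlinarith [sq_nonneg ‖p‖]
      rw [h1, h2]
      refine le_trans ?_ (mul_le_mul_of_nonneg_left h3 (norm_nonneg _))
      rw [abs_le]
      refine ⟨?_, inner_apply_le hT hγ he hr hx (hμ x hx)⟩
      -- Lower bound: `⟨T x, x⟩ ≥ ⟨(T - M) x, x⟩` by positivity of `M`.
      have h5 : -(‖T - M‖ * ‖x‖ ^ 2) ≤ inner ℝ ((T - M) x) x := by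
        have h6 := abs_le.1 (abs_real_inner_le_norm ((T - M) x) x)
        have h7 := mul_le_mul_of_nonneg_right ((T - M).le_opNorm x) (norm_nonneg x)
        nlinarith [h6.1]
      have h8 : inner ℝ ((T - M) x) x = inner ℝ (T x) x - inner ℝ (M x) x := by
        rw [← inner_sub_left]; rfl
      linarith [hM x]
  calc ‖S - M‖ = ‖(T - M) - (T - S)‖ := by congr 1; abel
    _ ≤ ‖T - M‖ + ‖T - S‖ := _root_.norm_sub_le _ _
    _ ≤ 2 * ‖T - M‖ := by linarith

end Operators
-- The integral representation of the Euclidean norm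
section Fourier

open Set

theorem lintegral_rpow_mul_exp_neg_mul {p r : ℝ} (hp : 0 < p) (hr : 0 < r) :
    ∫⁻ t in Ioi (0 : ℝ), ENNReal.ofReal (t ^ (p - 1) * Real.exp (-(r * t))) =
      ENNReal.ofReal (r ^ (-p) * Real.Gamma p) := by
  have h := Real.integral_rpow_mul_exp_neg_mul_Ioi hp hr
  rw [one_div, Real.inv_rpow hr.le, ← Real.rpow_neg hr.le] at h
  have hpos : 0 < r ^ (-p) * Real.Gamma p :=
    mul_pos (Real.rpow_pos_of_pos hr _) (Real.Gamma_pos_of_pos hp)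
  rw [← h, ofReal_integral_eq_lintegral_ofReal]
  · exact Integrable.of_integral_ne_zero (h ▸ hpos.ne')
  · filter_upwards [self_mem_ae_restrict measurableSet_Ioi] with t ht
    exact mul_nonneg (Real.rpow_nonneg (le_of_lt ht) _) (Real.exp_pos _).le

theorem lintegral_rpow_mul_exp_neg_div {p r : ℝ} (hp : 0 < p) (hr : 0 < r) :
    ∫⁻ u in Ioi (0 : ℝ), ENNReal.ofReal (u ^ (-p - 1) * Real.exp (-(r / u))) =
      ENNReal.ofReal (r ^ (-p) * Real.Gamma p) := by
  have h := Real.integral_rpow_mul_exp_neg_mul_Ioi hp hr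
  -- The substitution `t = 1 / u` in the Gamma integral.
  rw [one_div, Real.inv_rpow hr.le, ← Real.rpow_neg hr.le,
    ← integral_comp_rpow_Ioi _ (show (-1 : ℝ) ≠ 0 by norm_num)] at h
  have hpos : 0 < r ^ (-p) * Real.Gamma p :=
    mul_pos (Real.rpow_pos_of_pos hr _) (Real.Gamma_pos_of_pos hp)
  have heq : ∫ u in Ioi (0 : ℝ), (|(-1 : ℝ)| * u ^ ((-1 : ℝ) - 1)) •
        ((u ^ (-1 : ℝ)) ^ (p - 1) * Real.exp (-(r * u ^ (-1 : ℝ)))) =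
      ∫ u in Ioi (0 : ℝ), u ^ (-p - 1) * Real.exp (-(r / u)) := by
    refine setIntegral_congr_fun measurableSet_Ioi fun u hu => ?_
    have hu : 0 < u := hu
    simp only [abs_neg, abs_one, one_mul, smul_eq_mul]
    rw [← Real.rpow_mul hu.le, ← mul_assoc, ← Real.rpow_add hu, Real.rpow_neg_one, div_eq_mul_inv]
    ring_nf
  rw [heq] at h
  rw [← h, ofReal_integral_eq_lintegral_ofReal]
  · exact Integrable.of_integral_ne_zero (h ▸ hpos.ne')
  · filter_upwards [self_mem_ae_restrict measurableSet_Ioi] with t ht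
    exact mul_nonneg (Real.rpow_nonneg (le_of_lt ht) _) (Real.exp_pos _).le

theorem ofReal_one_sub_exp_neg {u A : ℝ} (hu : 0 < u) (hA : 0 ≤ A) :
    ENNReal.ofReal (1 - Real.exp (-(A * u))) =
      ∫⁻ v in Ioc 0 A, ENNReal.ofReal (u * Real.exp (-(v * u))) := by
  have hd : ∀ v ∈ uIcc 0 A, HasDerivAt (fun v => -Real.exp (-(v * u)))
      (u * Real.exp (-(v * u))) v := fun v _ => by
    have := ((hasDerivAt_id v).mul_const u).neg.exp.neg
    refine (this.congr_deriv ?_)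
    simp [mul_comm]
  have hc : Continuous fun v => u * Real.exp (-(v * u)) := by fun_prop
  have hi := intervalIntegral.integral_eq_sub_of_hasDerivAt hd (hc.intervalIntegrable _ _)
  rw [intervalIntegral.integral_of_le hA] at hi
  rw [← ofReal_integral_eq_lintegral_ofReal, hi]
  · simp
    ring_nf
  · exact (hc.integrableOn_Icc).mono_set Ioc_subset_Icc_self
  · exact Filter.Eventually.of_forall fun v => by positivity

/-- Writing `1 - exp(-A u)` as the integral of `u exp(-v u)` over `v` in `(0, A]` and exchanging the
integrals leaves `Γ(1/2)` times the integral of `v^(-1/2)`. -/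
theorem lintegral_rpow_mul_one_sub_exp {A : ℝ} (hA : 0 ≤ A) :
    ∫⁻ u in Ioi (0 : ℝ), ENNReal.ofReal (u ^ (-3 / 2 : ℝ) * (1 - Real.exp (-(A * u)))) =
      ENNReal.ofReal (2 * √Real.pi * √A) := by
  have h1 : ∫⁻ u in Ioi (0 : ℝ), ENNReal.ofReal (u ^ (-3 / 2 : ℝ) * (1 - Real.exp (-(A * u)))) =
      ∫⁻ u in Ioi (0 : ℝ), ∫⁻ v in Ioc 0 A,
        ENNReal.ofReal (u ^ ((1 / 2 : ℝ) - 1) * Real.exp (-(v * u))) := by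
    refine setLIntegral_congr_fun measurableSet_Ioi fun u hu => ?_
    have hu : 0 < u := hu
    rw [ENNReal.ofReal_mul (Real.rpow_nonneg hu.le _), ofReal_one_sub_exp_neg hu hA,
      ← lintegral_const_mul _ (by fun_prop)]
    refine lintegral_congr fun v => ?_
    rw [← ENNReal.ofReal_mul (Real.rpow_nonneg hu.le _), ← mul_assoc,
      ← Real.rpow_add_one hu.ne']
    norm_num
  rw [h1, lintegral_lintegral_swap]
  · have h2 : ∫⁻ v in Ioc 0 A, ∫⁻ u in Ioi (0 : ℝ),
          ENNReal.ofReal (u ^ ((1 / 2 : ℝ) - 1) * Real.exp (-(v * u))) =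
        ∫⁻ v in Ioc 0 A, ENNReal.ofReal (v ^ (-(1 / 2) : ℝ) * √Real.pi) := by
      refine setLIntegral_congr_fun measurableSet_Ioc fun v hv => ?_
      rw [lintegral_rpow_mul_exp_neg_mul (by norm_num) hv.1, Real.Gamma_one_half_eq]
    rw [h2, ← ofReal_integral_eq_lintegral_ofReal, integral_mul_const,
      ← intervalIntegral.integral_of_le hA, integral_rpow (by left; norm_num)]
    · congr 1
      rw [Real.sqrt_eq_rpow A]
      norm_num
      ring
    · refine Integrable.mul_const ?_ _
      have := intervalIntegral.intervalIntegrable_rpow' (a := 0) (b := A)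
        (show (-1 : ℝ) < -(1 / 2) by norm_num)
      exact (intervalIntegrable_iff_integrableOn_Ioc_of_le hA).1 this
    · filter_upwards [self_mem_ae_restrict measurableSet_Ioc] with t ht
      exact mul_nonneg (Real.rpow_nonneg ht.1.le _) (Real.sqrt_nonneg _)
  · refine Measurable.aemeasurable ?_
    fun_prop

variable {q : ℕ}

theorem integrable_exp_neg_mul_sq_norm {b : ℝ} (hb : 0 < b) :
    Integrable fun s : EuclideanSpace ℝ (Fin q) => Real.exp (-b * ‖s‖ ^ 2) := by
  refine Integrable.of_integral_ne_zero ?_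
  rw [GaussianFourier.integral_rexp_neg_mul_sq_norm hb]
  positivity

theorem integral_cos_mul_exp_neg {b : ℝ} (hb : 0 < b) (x : EuclideanSpace ℝ (Fin q)) :
    ∫ s : EuclideanSpace ℝ (Fin q), Real.cos (inner ℝ s x) * Real.exp (-b * ‖s‖ ^ 2) =
      (Real.pi / b) ^ ((q : ℝ) / 2) * Real.exp (-(‖x‖ ^ 2 / (4 * b))) := by
  have h := GaussianFourier.integral_cexp_neg_mul_sq_norm_add
    (show 0 < (b : ℂ).re from hb) Complex.I x
  have hf : ∀ s : EuclideanSpace ℝ (Fin q),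
      Complex.exp (-(b : ℂ) * (‖s‖ : ℂ) ^ 2 + Complex.I * (inner ℝ x s : ℝ)) =
        ((Real.exp (-b * ‖s‖ ^ 2) : ℝ) : ℂ) * Complex.exp ((inner ℝ x s : ℝ) * Complex.I) :=
    fun s => by
      rw [Complex.exp_add, mul_comm Complex.I]
      push_cast
      rfl
  have hint : Integrable fun s : EuclideanSpace ℝ (Fin q) =>
      Complex.exp (-(b : ℂ) * (‖s‖ : ℂ) ^ 2 + Complex.I * (inner ℝ x s : ℝ)) := by
    refine (integrable_exp_neg_mul_sq_norm (q := q) hb).mono' ?_ ?_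
    · exact Continuous.aestronglyMeasurable (by fun_prop)
    · refine Filter.Eventually.of_forall fun s => ?_
      rw [hf, norm_mul, Complex.norm_exp_ofReal_mul_I, mul_one, Complex.norm_real,
        Real.norm_eq_abs, abs_of_pos (Real.exp_pos _)]
  have h2 := congrArg Complex.re h
  rw [← RCLike.re_eq_complex_re, ← integral_re hint] at h2
  simp only [hf, RCLike.re_eq_complex_re, Complex.re_ofReal_mul, Complex.exp_ofReal_mul_I_re] at h2
  simp_rw [mul_comm (Real.cos _), real_inner_comm x]
  rw [h2]
  have h3 : ((Real.pi : ℂ) / (b : ℂ)) ^ ((Module.finrank ℝ (EuclideanSpace ℝ (Fin q)) : ℂ) / 2) *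
      Complex.exp (Complex.I ^ 2 * (‖x‖ : ℂ) ^ 2 / (4 * (b : ℂ))) =
      (((Real.pi / b) ^ ((q : ℝ) / 2) * Real.exp (-(‖x‖ ^ 2 / (4 * b))) : ℝ) : ℂ) := by
    rw [finrank_euclideanSpace_fin, Complex.ofReal_mul, Complex.ofReal_cpow (by positivity)]
    push_cast
    rw [Complex.I_sq]
    congr 2
    ring
  rw [h3, Complex.ofReal_re]

theorem lintegral_one_sub_cos_mul_exp_neg {b : ℝ} (hb : 0 < b) (x : EuclideanSpace ℝ (Fin q)) :
    ∫⁻ s : EuclideanSpace ℝ (Fin q),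
        ENNReal.ofReal ((1 - Real.cos (inner ℝ s x)) * Real.exp (-b * ‖s‖ ^ 2)) =
      ENNReal.ofReal ((Real.pi / b) ^ ((q : ℝ) / 2) * (1 - Real.exp (-(‖x‖ ^ 2 / (4 * b))))) := by
  have hi := integrable_exp_neg_mul_sq_norm (q := q) hb
  have hic : Integrable fun s : EuclideanSpace ℝ (Fin q) =>
      Real.cos (inner ℝ s x) * Real.exp (-b * ‖s‖ ^ 2) := by
    refine hi.mono' (Continuous.aestronglyMeasurable (by fun_prop)) ?_
    refine Filter.Eventually.of_forall fun s => ?_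
    rw [norm_mul, Real.norm_eq_abs, Real.norm_eq_abs, abs_of_pos (Real.exp_pos _)]
    exact mul_le_of_le_one_left (Real.exp_pos _).le (Real.abs_cos_le_one _)
  rw [← ofReal_integral_eq_lintegral_ofReal]
  · simp_rw [sub_mul, one_mul]
    rw [integral_sub hi hic, integral_cos_mul_exp_neg hb,
      GaussianFourier.integral_rexp_neg_mul_sq_norm hb, finrank_euclideanSpace_fin, mul_sub,
      mul_one]
  · refine (hi.sub hic).congr (Filter.Eventually.of_forall fun s => ?_)
    simp [sub_mul]
  · refine Filter.Eventually.of_forall fun s => ?_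
    exact mul_nonneg (sub_nonneg.2 (Real.cos_le_one _)) (Real.exp_pos _).le

theorem mddConst_pos (q : ℕ) : 0 < mddConst q := by
  have : 0 < Real.Gamma (((q : ℝ) + 1) / 2) := Real.Gamma_pos_of_pos (by positivity)
  rw [mddConst]
  positivity

/-- Subordination: `‖s‖^(-(1+q))` is a mixture of the Gaussians `exp(-‖s‖² / u)` with weight
`u^(-p-1) / Γ(p)`, `p = (q+1)/2`. After Tonelli the `s`-integral is a Gaussian Fourier transform and
the powers of `u` combine to `u^(-3/2)`. With values in `[0, ∞]` the exchange needs only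
measurability, and finiteness comes out as a result. -/
theorem lintegral_one_sub_cos_div_norm_pow (x : EuclideanSpace ℝ (Fin q)) :
    ∫⁻ s : EuclideanSpace ℝ (Fin q),
        ENNReal.ofReal ((1 - Real.cos (inner ℝ s x)) / ‖s‖ ^ (1 + q)) =
      ENNReal.ofReal (mddConst q * ‖x‖) := by
  set p : ℝ := ((q : ℝ) + 1) / 2 with hp
  have hp0 : 0 < p := by positivity
  have hG : 0 < Real.Gamma p := Real.Gamma_pos_of_pos hp0
  have h1 : ∀ s : EuclideanSpace ℝ (Fin q),
      ENNReal.ofReal ((1 - Real.cos (inner ℝ s x)) / ‖s‖ ^ (1 + q)) =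
        ∫⁻ u in Ioi (0 : ℝ), ENNReal.ofReal ((1 - Real.cos (inner ℝ s x)) * (Real.Gamma p)⁻¹ *
          (u ^ (-p - 1) * Real.exp (-(‖s‖ ^ 2 / u)))) := by
    intro s
    rcases eq_or_ne s 0 with rfl | hs
    · simp
    have hs' : 0 < ‖s‖ := norm_pos_iff.2 hs
    have hc : 0 ≤ (1 - Real.cos (inner ℝ s x)) * (Real.Gamma p)⁻¹ :=
      mul_nonneg (sub_nonneg.2 (Real.cos_le_one _)) (by positivity)
    simp_rw [ENNReal.ofReal_mul hc]
    rw [lintegral_const_mul _ (by fun_prop), lintegral_rpow_mul_exp_neg_div hp0 (by positivity),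
      ← ENNReal.ofReal_mul hc]
    congr 1
    have : (‖s‖ ^ 2) ^ (-p) = (‖s‖ ^ (1 + q))⁻¹ := by
      rw [← Real.rpow_natCast, ← Real.rpow_mul hs'.le, ← Real.rpow_natCast, ← Real.rpow_neg hs'.le]
      congr 1
      rw [hp]
      push_cast
      ring
    rw [this]
    field_simp
  simp_rw [h1]
  rw [lintegral_lintegral_swap]
  · have h2 : ∫⁻ u in Ioi (0 : ℝ), ∫⁻ s : EuclideanSpace ℝ (Fin q),
          ENNReal.ofReal ((1 - Real.cos (inner ℝ s x)) * (Real.Gamma p)⁻¹ *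
            (u ^ (-p - 1) * Real.exp (-(‖s‖ ^ 2 / u)))) =
        ∫⁻ u in Ioi (0 : ℝ), ENNReal.ofReal ((Real.Gamma p)⁻¹ * Real.pi ^ ((q : ℝ) / 2)) *
          ENNReal.ofReal (u ^ (-3 / 2 : ℝ) * (1 - Real.exp (-(‖x‖ ^ 2 / 4 * u)))) := by
      refine setLIntegral_congr_fun measurableSet_Ioi fun u hu => ?_
      have hu : 0 < u := hu
      have hc : 0 ≤ (Real.Gamma p)⁻¹ * u ^ (-p - 1) := by positivity
      have h3 : ∀ s : EuclideanSpace ℝ (Fin q),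
          ENNReal.ofReal ((1 - Real.cos (inner ℝ s x)) * (Real.Gamma p)⁻¹ *
            (u ^ (-p - 1) * Real.exp (-(‖s‖ ^ 2 / u)))) =
          ENNReal.ofReal ((Real.Gamma p)⁻¹ * u ^ (-p - 1)) *
            ENNReal.ofReal ((1 - Real.cos (inner ℝ s x)) * Real.exp (-u⁻¹ * ‖s‖ ^ 2)) := by
        intro s
        rw [← ENNReal.ofReal_mul hc]
        congr 1
        rw [div_eq_inv_mul, neg_mul]
        ring
      simp_rw [h3]
      rw [lintegral_const_mul _ (by fun_prop),
        lintegral_one_sub_cos_mul_exp_neg (inv_pos.2 hu), ← ENNReal.ofReal_mul hc,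
        ← ENNReal.ofReal_mul (by positivity)]
      congr 1
      have h4 : u ^ (-p - 1) * (Real.pi / u⁻¹) ^ ((q : ℝ) / 2) =
          Real.pi ^ ((q : ℝ) / 2) * u ^ (-3 / 2 : ℝ) := by
        rw [div_inv_eq_mul, Real.mul_rpow Real.pi_pos.le hu.le, mul_left_comm,
          ← Real.rpow_add hu]
        congr 2
        rw [hp]
        ring
      have h5 : ‖x‖ ^ 2 / (4 * u⁻¹) = ‖x‖ ^ 2 / 4 * u := by field_simp
      rw [h5]
      linear_combination (Real.Gamma p)⁻¹ * (1 - Real.exp (-(‖x‖ ^ 2 / 4 * u))) * h4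
    rw [h2, lintegral_const_mul _ (by fun_prop), lintegral_rpow_mul_one_sub_exp (by positivity),
      ← ENNReal.ofReal_mul (by positivity)]
    congr 1
    have h6 : √(‖x‖ ^ 2 / 4) = ‖x‖ / 2 := by
      rw [show ‖x‖ ^ 2 / 4 = (‖x‖ / 2) ^ 2 by ring]
      exact Real.sqrt_sq (by positivity)
    have h7 : Real.pi ^ (((q : ℝ) + 1) / 2) = Real.pi ^ ((q : ℝ) / 2) * √Real.pi := by
      rw [Real.sqrt_eq_rpow, ← Real.rpow_add Real.pi_pos]
      congr 1
      ring
    rw [mddConst, h7, h6, ← hp]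
    field_simp
  · refine Measurable.aemeasurable ?_
    fun_prop

end Fourier
-- Principal values over annuli
section Truncation

open Set

variable {q : ℕ}

/-- The annulus over which the truncated integrals are taken. -/
def annulus (q : ℕ) (ε : ℝ) : Set (EuclideanSpace ℝ (Fin q)) := {s | ε ≤ ‖s‖ ∧ ‖s‖ ≤ ε⁻¹}

theorem isCompact_annulus (q : ℕ) (ε : ℝ) : IsCompact (annulus q ε) := by
  have h : annulus q ε = Metric.closedBall 0 ε⁻¹ ∩ {s | ε ≤ ‖s‖} := by
    ext s; simp [annulus, and_comm]
  rw [h]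
  exact (isCompact_closedBall _ _).inter_right (isClosed_le continuous_const continuous_norm)

theorem measurableSet_annulus (q : ℕ) (ε : ℝ) : MeasurableSet (annulus q ε) :=
  (isCompact_annulus q ε).isClosed.measurableSet

/-- The kernel `(1 - cos ⟨s, x⟩) / ‖s‖^{1+q}`. -/
def cosKernel (s x : EuclideanSpace ℝ (Fin q)) : ℝ :=
  (1 - Real.cos (inner ℝ s x)) / ‖s‖ ^ (1 + q)

theorem cosKernel_nonneg (s x : EuclideanSpace ℝ (Fin q)) : 0 ≤ cosKernel s x :=
  div_nonneg (sub_nonneg.2 (Real.cos_le_one _)) (by positivity)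

theorem measurable_cosKernel :
    Measurable fun p : EuclideanSpace ℝ (Fin q) × EuclideanSpace ℝ (Fin q) =>
      cosKernel p.1 p.2 := by
  unfold cosKernel
  fun_prop

theorem integrable_cosKernel (x : EuclideanSpace ℝ (Fin q)) :
    Integrable fun s => cosKernel s x := by
  refine ⟨?_, ?_⟩
  · exact (measurable_cosKernel.comp (measurable_id.prodMk measurable_const)).aestronglyMeasurable
  · rw [hasFiniteIntegral_iff_ofReal (Filter.Eventually.of_forall fun s => cosKernel_nonneg s x)]
    exact (lintegral_one_sub_cos_div_norm_pow x).trans_lt ENNReal.ofReal_lt_top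

theorem integral_cosKernel (x : EuclideanSpace ℝ (Fin q)) :
    ∫ s, cosKernel s x = mddConst q * ‖x‖ := by
  rw [integral_eq_lintegral_of_nonneg_ae
    (Filter.Eventually.of_forall fun s => cosKernel_nonneg s x)
    (integrable_cosKernel x).aestronglyMeasurable]
  refine (congrArg _ (lintegral_one_sub_cos_div_norm_pow x)).trans ?_
  exact ENNReal.toReal_ofReal (mul_nonneg (mddConst_pos q).le (norm_nonneg _))

theorem setIntegral_cosKernel_le (ε : ℝ) (x : EuclideanSpace ℝ (Fin q)) :
    ∫ s in annulus q ε, cosKernel s x ≤ mddConst q * ‖x‖ := by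
  rw [← integral_cosKernel]
  exact setIntegral_le_integral (integrable_cosKernel x)
    (Filter.Eventually.of_forall fun s => cosKernel_nonneg s x)

theorem tendsto_setIntegral_cosKernel (x : EuclideanSpace ℝ (Fin q)) :
    Tendsto (fun ε => ∫ s in annulus q ε, cosKernel s x) (𝓝[>] 0)
      (𝓝 (mddConst q * ‖x‖)) := by
  rw [← integral_cosKernel]
  simp_rw [← integral_indicator (measurableSet_annulus q _)]
  refine tendsto_integral_filter_of_dominated_convergence (fun s => cosKernel s x) ?_ ?_
    (integrable_cosKernel x) ?_
  · exact Filter.Eventually.of_forall fun ε =>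
      (integrable_cosKernel x).aestronglyMeasurable.indicator (measurableSet_annulus q ε)
  · refine Filter.Eventually.of_forall fun ε => Filter.Eventually.of_forall fun s => ?_
    refine (norm_indicator_le_norm_self _ _).trans_eq ?_
    rw [Real.norm_eq_abs, abs_of_nonneg (cosKernel_nonneg s x)]
  · refine Filter.Eventually.of_forall fun s => ?_
    rcases eq_or_ne s 0 with rfl | hs
    · have h0 : cosKernel 0 x = 0 := by simp [cosKernel]
      have : ∀ ε, (annulus q ε).indicator (fun s => cosKernel s x) 0 = 0 := fun ε =>
        Set.indicator_apply_eq_zero.2 fun _ => h0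
      simp only [this, h0, tendsto_const_nhds_iff]
    · have hs' : 0 < ‖s‖ := norm_pos_iff.2 hs
      refine tendsto_const_nhds.congr' ?_
      have h1 : ∀ᶠ ε : ℝ in 𝓝[>] 0, ε < min ‖s‖ ‖s‖⁻¹ :=
        (eventually_lt_nhds (by positivity)).filter_mono nhdsWithin_le_nhds
      filter_upwards [h1, self_mem_nhdsWithin] with ε hε hpos
      rw [Set.indicator_of_mem]
      refine ⟨(hε.trans_le (min_le_left _ _)).le, ?_⟩
      rw [le_inv_comm₀ hs' hpos]
      exact (hε.trans_le (min_le_right _ _)).le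

variable {Ω : Type*} [MeasurableSpace Ω] {P : Measure Ω} [IsProbabilityMeasure P]
variable {Y : Ω → EuclideanSpace ℝ (Fin q)} {u v : Ω → ℝ}

omit [IsProbabilityMeasure P] in
theorem integrable_cos_mul (hY : Measurable Y) (hu : Integrable u P)
    (s : EuclideanSpace ℝ (Fin q)) :
    Integrable (fun ω => Real.cos (inner ℝ s (Y ω)) * u ω) P := by
  refine hu.bdd_mul (c := 1) ?_ ?_
  · exact Measurable.aestronglyMeasurable (by fun_prop)
  · exact Filter.Eventually.of_forall fun ω => Real.abs_cos_le_one _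

omit [IsProbabilityMeasure P] in
theorem integrable_sin_mul (hY : Measurable Y) (hu : Integrable u P)
    (s : EuclideanSpace ℝ (Fin q)) :
    Integrable (fun ω => Real.sin (inner ℝ s (Y ω)) * u ω) P := by
  refine hu.bdd_mul (c := 1) ?_ ?_
  · exact Measurable.aestronglyMeasurable (by fun_prop)
  · exact Filter.Eventually.of_forall fun ω => Real.abs_sin_le_one _

omit [IsProbabilityMeasure P] in
theorem continuous_integral_cos_mul (hY : Measurable Y) (hu : Integrable u P) :
    Continuous fun s => ∫ ω, Real.cos (inner ℝ s (Y ω)) * u ω ∂P := by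
  refine continuous_of_dominated (bound := fun ω => |u ω|)
    (fun s => (integrable_cos_mul hY hu s).aestronglyMeasurable) (fun s => ?_) hu.abs ?_
  · refine Filter.Eventually.of_forall fun ω => ?_
    rw [norm_mul]
    exact mul_le_of_le_one_left (abs_nonneg _) (Real.abs_cos_le_one _)
  · exact Filter.Eventually.of_forall fun ω => by fun_prop

omit [IsProbabilityMeasure P] in
theorem continuous_integral_sin_mul (hY : Measurable Y) (hu : Integrable u P) :
    Continuous fun s => ∫ ω, Real.sin (inner ℝ s (Y ω)) * u ω ∂P := by
  refine continuous_of_dominated (bound := fun ω => |u ω|)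
    (fun s => (integrable_sin_mul hY hu s).aestronglyMeasurable) (fun s => ?_) hu.abs ?_
  · refine Filter.Eventually.of_forall fun ω => ?_
    rw [norm_mul]
    exact mul_le_of_le_one_left (abs_nonneg _) (Real.abs_sin_le_one _)
  · exact Filter.Eventually.of_forall fun ω => by fun_prop

/-- The addition formula turns the products into `E cos⟨s, Y - Y'⟩ u v'`; replacing `cos` by `cos -
1` costs nothing because `E u v' = E u · E v = 0`. -/
theorem charFun_product_eq (hY : Measurable Y) (hu : Integrable u P) (hv : Integrable v P)
    (hu0 : ∫ ω, u ω ∂P = 0) (s : EuclideanSpace ℝ (Fin q)) :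
    ((∫ ω, Real.cos (inner ℝ s (Y ω)) * u ω ∂P) * (∫ ω, Real.cos (inner ℝ s (Y ω)) * v ω ∂P) +
      (∫ ω, Real.sin (inner ℝ s (Y ω)) * u ω ∂P) * (∫ ω, Real.sin (inner ℝ s (Y ω)) * v ω ∂P)) /
        ‖s‖ ^ (1 + q) =
      -∫ p, cosKernel s (Y p.1 - Y p.2) * (u p.1 * v p.2) ∂(P.prod P) := by
  have hc := (integrable_cos_mul hY hu s).mul_prod (integrable_cos_mul hY hv s)
  have hs := (integrable_sin_mul hY hu s).mul_prod (integrable_sin_mul hY hv s)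
  have huv := hu.mul_prod hv
  have h0 : ∫ p, u p.1 * v p.2 ∂(P.prod P) = 0 := by
    rw [integral_prod_mul, hu0, zero_mul]
  rw [← integral_prod_mul, ← integral_prod_mul, ← integral_add hc hs]
  have h1 : ∀ p : Ω × Ω, cosKernel s (Y p.1 - Y p.2) * (u p.1 * v p.2) =
      (u p.1 * v p.2 - (Real.cos (inner ℝ s (Y p.1)) * u p.1 *
        (Real.cos (inner ℝ s (Y p.2)) * v p.2) + Real.sin (inner ℝ s (Y p.1)) * u p.1 *
        (Real.sin (inner ℝ s (Y p.2)) * v p.2))) / ‖s‖ ^ (1 + q) := fun p => by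
    rw [cosKernel, inner_sub_right, Real.cos_sub]
    ring
  simp_rw [h1]
  rw [integral_div]
  have h2 := integral_sub huv (hc.add hs)
  simp only [Pi.add_apply] at h2
  rw [h2, h0]
  ring

omit [IsProbabilityMeasure P] in
theorem integrable_norm_sub_mul (hY : Measurable Y) (hu : Integrable u P) (hv : Integrable v P)
    (huY : Integrable (fun ω => ‖Y ω‖ * u ω) P) (hvY : Integrable (fun ω => ‖Y ω‖ * v ω) P) :
    Integrable (fun p : Ω × Ω => ‖Y p.1 - Y p.2‖ * (u p.1 * v p.2)) (P.prod P) := by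
  have h := (huY.mul_prod hv).norm.add (hu.mul_prod hvY).norm
  refine h.mono' ?_ (Filter.Eventually.of_forall fun p => ?_)
  · refine AEStronglyMeasurable.mul ?_ (hu.mul_prod hv).aestronglyMeasurable
    exact Measurable.aestronglyMeasurable (by fun_prop)
  · simp only [Pi.add_apply, norm_mul, norm_norm]
    calc ‖Y p.1 - Y p.2‖ * (‖u p.1‖ * ‖v p.2‖)
        ≤ (‖Y p.1‖ + ‖Y p.2‖) * (‖u p.1‖ * ‖v p.2‖) := by
          gcongr
          exact norm_sub_le _ _
      _ = _ := by ring

-- Fubini is legitimate on each annulus, where the kernel is bounded by `2 / ε^(1+q)`.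
omit [IsProbabilityMeasure P] in
theorem integrable_cosKernel_mul (hY : Measurable Y) (hu : Integrable u P) (hv : Integrable v P)
    {ε : ℝ} (hε : 0 < ε) :
    Integrable (Function.uncurry fun (s : EuclideanSpace ℝ (Fin q)) (p : Ω × Ω) =>
      cosKernel s (Y p.1 - Y p.2) * (u p.1 * v p.2))
      ((volume.restrict (annulus q ε)).prod (P.prod P)) := by
  have hfin : IsFiniteMeasure (volume.restrict (annulus q ε)) :=
    ⟨by simpa using (isCompact_annulus q ε).measure_lt_top⟩
  have huv := hu.mul_prod hv
  have h : Integrable (fun z : EuclideanSpace ℝ (Fin q) × (Ω × Ω) =>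
      (2 / ε ^ (1 + q)) * ‖u z.2.1 * v z.2.2‖)
      ((volume.restrict (annulus q ε)).prod (P.prod P)) :=
    (integrable_const (2 / ε ^ (1 + q))).mul_prod huv.norm
  refine h.mono' ?_ ?_
  · refine AEStronglyMeasurable.mul ?_ huv.aestronglyMeasurable.comp_snd
    have hm : Measurable fun z : EuclideanSpace ℝ (Fin q) × (Ω × Ω) =>
        (z.1, Y z.2.1 - Y z.2.2) := by fun_prop
    exact (measurable_cosKernel.comp hm).aestronglyMeasurable
  · have hae : ∀ᵐ z : EuclideanSpace ℝ (Fin q) × (Ω × Ω)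
        ∂((volume.restrict (annulus q ε)).prod (P.prod P)), z.1 ∈ annulus q ε :=
      Measure.quasiMeasurePreserving_fst.ae (ae_restrict_mem (measurableSet_annulus q ε))
    filter_upwards [hae] with z hz
    change ‖cosKernel z.1 (Y z.2.1 - Y z.2.2) * (u z.2.1 * v z.2.2)‖ ≤ _
    rw [norm_mul]
    refine mul_le_mul_of_nonneg_right ?_ (norm_nonneg _)
    rw [Real.norm_eq_abs, abs_of_nonneg (cosKernel_nonneg _ _), cosKernel]
    have := Real.neg_one_le_cos (inner ℝ z.1 (Y z.2.1 - Y z.2.2))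
    gcongr
    · linarith
    · exact hz.1

/-- Fubini on each annulus, then dominated convergence in the pair of sample points: the kernel is
nonnegative, so its truncated integrals are dominated by their limit `c_q ‖Y - Y'‖`. -/
theorem tendsto_truncated_integral (hY : Measurable Y) (hu : Integrable u P)
    (hv : Integrable v P) (huY : Integrable (fun ω => ‖Y ω‖ * u ω) P)
    (hvY : Integrable (fun ω => ‖Y ω‖ * v ω) P) (hu0 : ∫ ω, u ω ∂P = 0) :
    Tendsto (fun ε => (1 / mddConst q) * ∫ s in annulus q ε,
      ((∫ ω, Real.cos (inner ℝ s (Y ω)) * u ω ∂P) * (∫ ω, Real.cos (inner ℝ s (Y ω)) * v ω ∂P) +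
      (∫ ω, Real.sin (inner ℝ s (Y ω)) * u ω ∂P) * (∫ ω, Real.sin (inner ℝ s (Y ω)) * v ω ∂P)) /
        ‖s‖ ^ (1 + q)) (𝓝[>] 0)
      (𝓝 (-∫ p, ‖Y p.1 - Y p.2‖ * (u p.1 * v p.2) ∂(P.prod P))) := by
  have hc := mddConst_pos q
  have hF : ∀ ε > 0, ∫ s in annulus q ε, ∫ p, cosKernel s (Y p.1 - Y p.2) * (u p.1 * v p.2)
      ∂(P.prod P) = ∫ p, (∫ s in annulus q ε, cosKernel s (Y p.1 - Y p.2)) * (u p.1 * v p.2)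
        ∂(P.prod P) := fun ε hε => by
    rw [integral_integral_swap (integrable_cosKernel_mul hY hu hv hε)]
    simp_rw [integral_mul_const]
  have hlim : Tendsto (fun ε => ∫ p, (∫ s in annulus q ε, cosKernel s (Y p.1 - Y p.2)) *
      (u p.1 * v p.2) ∂(P.prod P)) (𝓝[>] 0)
      (𝓝 (∫ p, mddConst q * ‖Y p.1 - Y p.2‖ * (u p.1 * v p.2) ∂(P.prod P))) := by
    refine tendsto_integral_filter_of_dominated_convergence
      (fun p => mddConst q * ‖‖Y p.1 - Y p.2‖ * (u p.1 * v p.2)‖) ?_ ?_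
      ((integrable_norm_sub_mul hY hu hv huY hvY).norm.const_mul _) ?_
    · filter_upwards [self_mem_nhdsWithin] with ε hε
      have := (integrable_cosKernel_mul hY hu hv hε).integral_prod_right.aestronglyMeasurable
      simpa only [Function.uncurry_apply_pair, integral_mul_const] using this
    · refine Filter.Eventually.of_forall fun ε => Filter.Eventually.of_forall fun p => ?_
      rw [norm_mul, norm_mul _ (u p.1 * v p.2), norm_norm, ← mul_assoc, Real.norm_eq_abs,
        abs_of_nonneg (integral_nonneg fun s => cosKernel_nonneg s _)]
      exact mul_le_mul_of_nonneg_right (setIntegral_cosKernel_le _ _) (norm_nonneg _)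
    · exact Filter.Eventually.of_forall fun p =>
        (tendsto_setIntegral_cosKernel _).mul_const _
  have h2 := hlim.const_mul (-(1 / mddConst q))
  have h3 : -(1 / mddConst q) * ∫ p, mddConst q * ‖Y p.1 - Y p.2‖ * (u p.1 * v p.2) ∂(P.prod P) =
      -∫ p, ‖Y p.1 - Y p.2‖ * (u p.1 * v p.2) ∂(P.prod P) := by
    simp_rw [mul_assoc]
    rw [integral_const_mul]
    field_simp
  rw [h3] at h2
  refine h2.congr' ?_
  filter_upwards [self_mem_nhdsWithin] with ε hε
  simp_rw [charFun_product_eq hY hu hv hu0]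
  rw [integral_neg, hF ε hε]
  ring

end Truncation
-- The population operator: entries, positivity and rank
section MDDO

variable {Ω : Type*} [MeasurableSpace Ω] {P : Measure Ω} {q : ℕ}
variable {H : Type*} [NormedAddCommGroup H] [InnerProductSpace ℝ H] [CompleteSpace H]
variable {X : Ω → H} {Y : Ω → EuclideanSpace ℝ (Fin q)}

omit [CompleteSpace H] in
theorem mddo_eq_of_isMDDO {T : H →L[ℝ] H} (h : IsMDDO P X Y T) : mddo P X Y = T := by
  have h' : ∃ T, IsMDDO P X Y T := ⟨T, h⟩
  rw [mddo, dif_pos h']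
  exact h'.choose_spec.unique h

theorem integral_inner_left (hX : Integrable X P) (α : H) :
    inner ℝ (∫ ω, X ω ∂P) α = ∫ ω, inner ℝ (X ω) α ∂P := by
  rw [real_inner_comm, ← integral_inner hX]
  simp_rw [real_inner_comm α]

variable [IsProbabilityMeasure P]

omit [IsProbabilityMeasure P] in
theorem inner_gRe (hX : Integrable X P) (hX0 : ∫ ω, X ω ∂P = 0) (hY : Measurable Y)
    (s : EuclideanSpace ℝ (Fin q)) (α : H) :
    inner ℝ (gRe P X Y s) α = ∫ ω, Real.cos (inner ℝ s (Y ω)) * inner ℝ (X ω) α ∂P := by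
  have hi : Integrable (fun ω => Real.cos (inner ℝ s (Y ω)) • X ω) P := by
    refine hX.bdd_smul 1 ?_ ?_
    · exact Measurable.aestronglyMeasurable (by fun_prop)
    · exact Filter.Eventually.of_forall fun ω => Real.abs_cos_le_one _
  rw [gRe, hX0, smul_zero, sub_zero, integral_inner_left hi]
  simp_rw [real_inner_smul_left]

omit [IsProbabilityMeasure P] in
theorem inner_gIm (hX : Integrable X P) (hX0 : ∫ ω, X ω ∂P = 0) (hY : Measurable Y)
    (s : EuclideanSpace ℝ (Fin q)) (α : H) :
    inner ℝ (gIm P X Y s) α = ∫ ω, Real.sin (inner ℝ s (Y ω)) * inner ℝ (X ω) α ∂P := by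
  have hi : Integrable (fun ω => Real.sin (inner ℝ s (Y ω)) • X ω) P := by
    refine hX.bdd_smul 1 ?_ ?_
    · exact Measurable.aestronglyMeasurable (by fun_prop)
    · exact Filter.Eventually.of_forall fun ω => Real.abs_sin_le_one _
  rw [gIm, hX0, smul_zero, sub_zero, integral_inner_left hi]
  simp_rw [real_inner_smul_left]

omit [CompleteSpace H] [IsProbabilityMeasure P] in
theorem integrable_norm_mul_inner (hX : MemLp X 2 P) (hY : MemLp Y 2 P) (α : H) :
    Integrable (fun ω => ‖Y ω‖ * inner ℝ (X ω) α) P :=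
  hY.norm.integrable_mul (hX.inner_const α)

/-- The real part of the integrand is the expression treated by `tendsto_truncated_integral`. The
imaginary part integrates to zero, since `s ↦ -s` preserves each annulus and conjugates the
integrand. -/
theorem isMDDO_of_inner_eq (hX : MemLp X 2 P) (hX0 : ∫ ω, X ω ∂P = 0) (hYm : Measurable Y)
    (hY : MemLp Y 2 P) {T : H →L[ℝ] H}
    (hT : ∀ α β, inner ℝ (T α) β =
      -∫ p, ‖Y p.1 - Y p.2‖ * (inner ℝ (X p.1) α * inner ℝ (X p.2) β) ∂(P.prod P)) :
    IsMDDO P X Y T := by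
  intro α β
  have hXi : Integrable X P := hX.integrable one_le_two
  have hu : ∀ α : H, Integrable (fun ω => inner ℝ (X ω) α) P := fun α => hXi.inner_const α
  have hu0 : ∀ α : H, ∫ ω, inner ℝ (X ω) α ∂P = 0 := fun α => by
    rw [← integral_inner_left hXi, hX0, inner_zero_left]
  have hcont : ∀ α : H, Continuous fun s => gPair P X Y s α := fun α => by
    have h1 := continuous_integral_cos_mul hYm (hu α)
    have h2 := continuous_integral_sin_mul hYm (hu α)
    simp only [gPair, inner_gRe hXi hX0 hYm, inner_gIm hXi hX0 hYm]
    fun_prop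
  have hneg : ∀ (s : EuclideanSpace ℝ (Fin q)) (α : H),
      gPair P X Y (-s) α = (starRingEnd ℂ) (gPair P X Y s α) := fun s α => by
    simp only [gPair, inner_gRe hXi hX0 hYm, inner_gIm hXi hX0 hYm, inner_neg_left, Real.cos_neg,
      Real.sin_neg, neg_mul, integral_neg]
    simp
  set F : EuclideanSpace ℝ (Fin q) → ℂ := fun s =>
    gPair P X Y s α * (starRingEnd ℂ) (gPair P X Y s β) / ((‖s‖ ^ (1 + q) : ℝ) : ℂ) with hF
  have hFneg : ∀ s, F (-s) = (starRingEnd ℂ) (F s) := fun s => by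
    simp only [hF, hneg, norm_neg, map_div₀, map_mul, Complex.conj_ofReal]
  have hFre : ∀ s, (F s).re =
      ((∫ ω, Real.cos (inner ℝ s (Y ω)) * inner ℝ (X ω) α ∂P) *
          (∫ ω, Real.cos (inner ℝ s (Y ω)) * inner ℝ (X ω) β ∂P) +
        (∫ ω, Real.sin (inner ℝ s (Y ω)) * inner ℝ (X ω) α ∂P) *
          (∫ ω, Real.sin (inner ℝ s (Y ω)) * inner ℝ (X ω) β ∂P)) / ‖s‖ ^ (1 + q) := fun s => by
    simp only [hF, gPair, inner_gRe hXi hX0 hYm, inner_gIm hXi hX0 hYm, Complex.div_ofReal_re]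
    simp
  have hFint : ∀ ε > 0, IntegrableOn F (annulus q ε) := fun ε hε => by
    refine ContinuousOn.integrableOn_compact (isCompact_annulus q ε) ?_
    refine ContinuousOn.div ?_ ?_ ?_
    · have h1 := hcont α
      have h2 := hcont β
      exact (h1.mul (Complex.continuous_conj.comp h2)).continuousOn
    · exact Continuous.continuousOn (by fun_prop)
    · intro s hs
      have : 0 < ‖s‖ := hε.trans_le hs.1
      exact_mod_cast (pow_pos this _).ne'
  have hFreal : ∀ ε > 0, ∫ s in annulus q ε, F s =
      ((∫ s in annulus q ε, (F s).re : ℝ) : ℂ) := fun ε hε => by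
    have h1 : (starRingEnd ℂ) (∫ s in annulus q ε, F s) = ∫ s in annulus q ε, F s := by
      rw [← integral_conj]
      simp_rw [← hFneg]
      have hpre : (fun s : EuclideanSpace ℝ (Fin q) => -s) ⁻¹' annulus q ε = annulus q ε := by
        ext s; simp [annulus]
      have := (Measure.measurePreserving_neg
        (volume : Measure (EuclideanSpace ℝ (Fin q)))).setIntegral_preimage_emb
        (MeasurableEquiv.neg _).measurableEmbedding F (annulus q ε)
      rwa [hpre] at this
    rw [← Complex.conj_eq_iff_re.1 h1]
    congr 1
    exact (integral_re (hFint ε hε)).symm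
  have hlim := tendsto_truncated_integral hYm (hu α) (hu β)
    (integrable_norm_mul_inner hX hY α) (integrable_norm_mul_inner hX hY β) (hu0 α)
  rw [← hT] at hlim
  refine ((Complex.continuous_ofReal.tendsto _).comp hlim).congr' ?_
  filter_upwards [self_mem_nhdsWithin] with ε hε
  have h2 := hFreal ε hε
  simp_rw [hFre] at h2
  change _ = ((1 / mddConst q : ℝ) : ℂ) * ∫ s in annulus q ε, F s
  rw [h2, Function.comp_apply, Complex.ofReal_mul]

-- If the covariance of `E[X | m]` kills `x`, then `E ⟨E[X | m], x⟩² = 0`, so `⟨X, x⟩` has zero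
-- conditional expectation and is orthogonal to every bounded `m`-measurable function.
omit [MeasurableSpace Ω] in
theorem integral_mul_inner_eq_zero {m m₀ : MeasurableSpace Ω} {P : Measure Ω}
    [IsProbabilityMeasure P] (hm : m ≤ m₀) (hX : MemLp X 2 P) (hX0 : ∫ ω, X ω ∂P = 0) {x : H}
    (hx : covOp P (P[X | m]) x = 0) {f : Ω → ℝ} (hf : StronglyMeasurable[m] f) {c : ℝ}
    (hfc : ∀ ω, |f ω| ≤ c) :
    ∫ ω, f ω * inner ℝ (X ω) x ∂P = 0 := by
  have hXi : Integrable X P := hX.integrable one_le_two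
  have hW2 : MemLp (P[X | m]) 2 P := hX.condExp one_le_two
  have hW0 : ∫ ω, (P[X | m]) ω ∂P = 0 := by rw [integral_condExp hm, hX0]
  have hti : Integrable (fun ω => tensor ((P[X | m]) ω) ((P[X | m]) ω)) P := by
    have hct : Continuous fun z : H => tensor z z :=
      (rankOne ℝ : H →L[ℝ] H →L⋆[ℝ] H →L[ℝ] H).continuous₂.comp
        (continuous_id.prodMk continuous_id)
    refine (hW2.integrable_norm_pow two_ne_zero).mono'
      (hct.comp_aestronglyMeasurable hW2.aestronglyMeasurable) ?_
    refine Filter.Eventually.of_forall fun ω => ?_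
    simp [tensor, sq]
  have hsq : ∫ ω, inner ℝ ((P[X | m]) ω) x ^ 2 ∂P = 0 := by
    have h1 : inner ℝ (covOp P (P[X | m]) x) x = 0 := by rw [hx, inner_zero_left]
    simp only [covOp, hW0, sub_zero] at h1
    rw [ContinuousLinearMap.integral_apply hti,
      integral_inner_left (hti.apply_continuousLinearMap x)] at h1
    simpa [tensor_apply, real_inner_smul_left, sq] using h1
  have hWx : (fun ω => inner ℝ ((P[X | m]) ω) x) =ᵐ[P] 0 := by
    have h2 := (integral_eq_zero_iff_of_nonneg (fun ω => sq_nonneg _)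
      (hW2.inner_const x).integrable_sq).1 hsq
    filter_upwards [h2] with ω hω
    simpa using hω
  have hu : Integrable (fun ω => inner ℝ (X ω) x) P := hXi.inner_const x
  have hce : P[fun ω => inner ℝ (X ω) x | m] =ᵐ[P] 0 := by
    have h3 := (innerSL ℝ x).comp_condExp_comm (m := m) hXi
    have h4 : (⇑(innerSL ℝ x) ∘ X) = fun ω => inner ℝ (X ω) x := by
      ext ω; simp [real_inner_comm]
    rw [h4] at h3
    filter_upwards [h3, hWx] with ω h5 h6
    rw [← h5]
    simpa [real_inner_comm] using h6
  have hprod : Integrable (f * fun ω => inner ℝ (X ω) x) P :=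
    hu.bdd_mul (c := c) (hf.mono hm).aestronglyMeasurable
      (Filter.Eventually.of_forall fun ω => hfc _)
  have h7 := condExp_mul_of_stronglyMeasurable_left hf hprod hu
  have h8 : ∫ ω, (f * fun ω => inner ℝ (X ω) x) ω ∂P = 0 := by
    rw [← integral_condExp hm, integral_congr_ae h7]
    refine integral_eq_zero_of_ae ?_
    filter_upwards [hce] with ω hω
    simp [hω]
  exact h8

theorem _root_.LinearMap.rank_le_of_ker_le {V : Type*} [AddCommGroup V] [Module ℝ V]
    {f g : V →ₗ[ℝ] V} (h : LinearMap.ker f ≤ LinearMap.ker g) :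
    LinearMap.rank g ≤ LinearMap.rank f := by
  rw [LinearMap.rank, LinearMap.rank, ← f.quotKerEquivRange.rank_eq,
    ← Submodule.range_liftQ _ g h]
  exact rank_range_le _

/-- The number `E ‖Y - Y'‖ ⟨X, φ_a⟩ ⟨X', φ_b⟩` for an independent copy `(X', Y')` of `(X, Y)`. -/
def mddEntry (P : Measure Ω) (X : Ω → H) (Y : Ω → EuclideanSpace ℝ (Fin q)) (φ : ℕ → H)
    (a b : ℕ) : ℝ :=
  ∫ p, ‖Y p.1 - Y p.2‖ * (inner ℝ (X p.1) (φ a) * inner ℝ (X p.2) (φ b)) ∂(P.prod P)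

omit [CompleteSpace H] in
theorem inner_coordOp_mddEntry (hX : MemLp X 2 P) (hYm : Measurable Y) (hY : MemLp Y 2 P)
    (φ : ℕ → H) (m : ℕ) (α β : H) :
    inner ℝ (coordOp φ m (mddEntry P X Y φ) α) β =
      -∫ p, ‖Y p.1 - Y p.2‖ * (inner ℝ (truncProj φ m (X p.1)) α *
        inner ℝ (truncProj φ m (X p.2)) β) ∂(P.prod P) := by
  have hXi : Integrable X P := hX.integrable one_le_two
  have hi : ∀ a b, Integrable (fun p : Ω × Ω =>
      ‖Y p.1 - Y p.2‖ * (inner ℝ (X p.1) (φ a) * inner ℝ (X p.2) (φ b))) (P.prod P) := fun a b =>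
    integrable_norm_sub_mul hYm (hXi.inner_const _) (hXi.inner_const _)
      (integrable_norm_mul_inner hX hY _) (integrable_norm_mul_inner hX hY _)
  have h1 : ∀ p : Ω × Ω, ‖Y p.1 - Y p.2‖ * (inner ℝ (truncProj φ m (X p.1)) α *
        inner ℝ (truncProj φ m (X p.2)) β) =
      ∑ a ∈ Finset.range m, ∑ b ∈ Finset.range m,
        ‖Y p.1 - Y p.2‖ * (inner ℝ (X p.1) (φ a) * inner ℝ (X p.2) (φ b)) *
          (inner ℝ (φ a) α * inner ℝ (φ b) β) := fun p => by
    rw [inner_truncProj φ m (X p.1) α, inner_truncProj φ m (X p.2) β, Finset.sum_mul_sum,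
      Finset.mul_sum]
    refine Finset.sum_congr rfl fun a _ => ?_
    rw [Finset.mul_sum]
    exact Finset.sum_congr rfl fun b _ => by ring
  simp_rw [h1]
  rw [inner_coordOp, integral_finsetSum]
  · congr 1
    refine Finset.sum_congr rfl fun a _ => ?_
    rw [integral_finsetSum]
    · refine Finset.sum_congr rfl fun b _ => ?_
      rw [integral_mul_const, mddEntry]
    · exact fun b _ => (hi a b).mul_const _
  · exact fun a _ => integrable_finsetSum _ fun b _ => (hi a b).mul_const _

omit [CompleteSpace H] [IsProbabilityMeasure P] in
theorem memLp_truncProj (hX : MemLp X 2 P) (φ : ℕ → H) (m : ℕ) :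
    MemLp (fun ω => truncProj φ m (X ω)) 2 P :=
  (truncProj φ m).comp_memLp' hX

theorem integral_truncProj (hX : MemLp X 2 P) (hX0 : ∫ ω, X ω ∂P = 0) (φ : ℕ → H) (m : ℕ) :
    ∫ ω, truncProj φ m (X ω) ∂P = 0 := by
  rw [(truncProj φ m).integral_comp_comm (hX.integrable one_le_two), hX0, map_zero]

theorem mddo_truncProj (hX : MemLp X 2 P) (hX0 : ∫ ω, X ω ∂P = 0) (hYm : Measurable Y)
    (hY : MemLp Y 2 P) (φ : ℕ → H) (m : ℕ) :
    mddo P (fun ω => truncProj φ m (X ω)) Y = coordOp φ m (mddEntry P X Y φ) :=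
  mddo_eq_of_isMDDO <| isMDDO_of_inner_eq (memLp_truncProj hX φ m)
    (integral_truncProj hX hX0 φ m) hYm hY fun α β => inner_coordOp_mddEntry hX hYm hY φ m α β

/-- Keeps the principal value form of the operator available: positivity and the rank bound are both
read off from it. -/
theorem tendsto_inner_coordOp_mddEntry (hX : MemLp X 2 P) (hX0 : ∫ ω, X ω ∂P = 0)
    (hYm : Measurable Y) (hY : MemLp Y 2 P) (φ : ℕ → H) (m : ℕ) (α β : H) :
    Tendsto (fun ε => (1 / mddConst q) * ∫ s in annulus q ε,
      ((∫ ω, Real.cos (inner ℝ s (Y ω)) * inner ℝ (truncProj φ m (X ω)) α ∂P) *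
          (∫ ω, Real.cos (inner ℝ s (Y ω)) * inner ℝ (truncProj φ m (X ω)) β ∂P) +
        (∫ ω, Real.sin (inner ℝ s (Y ω)) * inner ℝ (truncProj φ m (X ω)) α ∂P) *
          (∫ ω, Real.sin (inner ℝ s (Y ω)) * inner ℝ (truncProj φ m (X ω)) β ∂P)) /
        ‖s‖ ^ (1 + q)) (𝓝[>] 0)
      (𝓝 (inner ℝ (coordOp φ m (mddEntry P X Y φ) α) β)) := by
  have hZ := memLp_truncProj hX φ m
  have hZi : Integrable (fun ω => truncProj φ m (X ω)) P := hZ.integrable one_le_two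
  rw [inner_coordOp_mddEntry hX hYm hY]
  refine tendsto_truncated_integral hYm (hZi.inner_const α) (hZi.inner_const β)
    (integrable_norm_mul_inner hZ hY α) (integrable_norm_mul_inner hZ hY β) ?_
  rw [← integral_inner_left hZi, integral_truncProj hX hX0, inner_zero_left]

theorem inner_coordOp_mddEntry_self_nonneg (hX : MemLp X 2 P) (hX0 : ∫ ω, X ω ∂P = 0)
    (hYm : Measurable Y) (hY : MemLp Y 2 P) (φ : ℕ → H) (m : ℕ) (α : H) :
    0 ≤ inner ℝ (coordOp φ m (mddEntry P X Y φ) α) α := by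
  refine ge_of_tendsto' (tendsto_inner_coordOp_mddEntry hX hX0 hYm hY φ m α α) fun ε => ?_
  refine mul_nonneg (one_div_nonneg.2 (mddConst_pos q).le) (integral_nonneg fun s => ?_)
  exact div_nonneg (add_nonneg (mul_self_nonneg _) (mul_self_nonneg _)) (by positivity)

/-- If `var(E[X | Y])` kills `Π_m α`, then `⟨Π_m X, α⟩ = ⟨X, Π_m α⟩` is orthogonal to `cos⟨s, Y⟩`
and `sin⟨s, Y⟩` for every `s`, so the operator kills `α`. Inclusion of kernels then compares ranks.
-/
theorem rank_coordOp_mddEntry_le (hX : MemLp X 2 P) (hX0 : ∫ ω, X ω ∂P = 0)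
    (hYm : Measurable Y) (hY : MemLp Y 2 P) (φ : ℕ → H) (m : ℕ) :
    LinearMap.rank (coordOp φ m (mddEntry P X Y φ)).toLinearMap ≤
      LinearMap.rank
        (covOp P (P[X | MeasurableSpace.comap Y inferInstance])).toLinearMap := by
  set V := covOp P (P[X | MeasurableSpace.comap Y inferInstance])
  refine le_trans (LinearMap.rank_le_of_ker_le (f := V.toLinearMap ∘ₗ (truncProj φ m).toLinearMap)
    fun α hα => ?_) (LinearMap.rank_comp_le_left _ _)
  have hα' : V (truncProj φ m α) = 0 := hα
  have hc : ∀ s, ∫ ω, Real.cos (inner ℝ s (Y ω)) * inner ℝ (truncProj φ m (X ω)) α ∂P = 0 :=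
    fun s => by
      simp_rw [inner_truncProj_comm φ m _ α]
      refine integral_mul_inner_eq_zero hYm.comap_le hX hX0 hα' (Measurable.stronglyMeasurable ?_)
        fun ω => Real.abs_cos_le_one _
      exact (show Measurable fun y : EuclideanSpace ℝ (Fin q) => Real.cos (inner ℝ s y) by
        fun_prop).comp (comap_measurable Y)
  have hs : ∀ s, ∫ ω, Real.sin (inner ℝ s (Y ω)) * inner ℝ (truncProj φ m (X ω)) α ∂P = 0 :=
    fun s => by
      simp_rw [inner_truncProj_comm φ m _ α]
      refine integral_mul_inner_eq_zero hYm.comap_le hX hX0 hα' (Measurable.stronglyMeasurable ?_)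
        fun ω => Real.abs_sin_le_one _
      exact (show Measurable fun y : EuclideanSpace ℝ (Fin q) => Real.sin (inner ℝ s y) by
        fun_prop).comp (comap_measurable Y)
  change coordOp φ m (mddEntry P X Y φ) α = 0
  refine ext_inner_right ℝ fun β => ?_
  rw [inner_zero_left]
  refine tendsto_nhds_unique (tendsto_inner_coordOp_mddEntry hX hX0 hYm hY φ m α β) ?_
  simp [hc, hs]

end MDDO
-- Chernoff bounds for sums with exponential moments
section Concentration

variable {α : Type*} [MeasurableSpace α] {μ : Measure α} [IsProbabilityMeasure μ]

theorem exp_le_one_add_add_sq_mul_exp_abs (x : ℝ) :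
    Real.exp x ≤ 1 + x + x ^ 2 * Real.exp |x| := by
  rcases le_total |x| 1 with h | h
  · have h1 := (abs_le.1 (Real.abs_exp_sub_one_sub_id_le h)).2
    have h2 : x ^ 2 * 1 ≤ x ^ 2 * Real.exp |x| :=
      mul_le_mul_of_nonneg_left (Real.one_le_exp (abs_nonneg x)) (sq_nonneg x)
    linarith
  · rcases le_total 0 x with h0 | h0
    · rw [abs_of_nonneg h0] at h ⊢
      nlinarith [Real.exp_pos x, mul_le_mul_of_nonneg_right (show 1 ≤ x ^ 2 by nlinarith)
        (Real.exp_pos x).le]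
    · have h1 : Real.exp x ≤ 1 := Real.exp_le_one_iff.2 h0
      have h2 : x ^ 2 * 1 ≤ x ^ 2 * Real.exp |x| :=
        mul_le_mul_of_nonneg_left (Real.one_le_exp (abs_nonneg x)) (sq_nonneg x)
      rw [abs_of_nonpos h0] at h
      nlinarith

/-- Half of the exponent `κ |x|` absorbs the square `(t x)²`, the other half absorbs `exp |t x|`. -/
theorem exp_mul_le_of_abs_le {κ t x : ℝ} (hκ : 0 < κ) (ht : |t| ≤ κ / 2) :
    Real.exp (t * x) ≤ 1 + t * x + 8 * t ^ 2 / κ ^ 2 * Real.exp (κ * |x|) := by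
  refine (exp_le_one_add_add_sq_mul_exp_abs (t * x)).trans ?_
  gcongr 1 + t * x + ?_
  have h1 : |t * x| ≤ κ * |x| / 2 := by
    rw [abs_mul]
    nlinarith [abs_nonneg x]
  have h2 : (κ * |x| / 2) ^ 2 ≤ 2 * Real.exp (κ * |x| / 2) := by
    have h0 : 0 ≤ κ * |x| / 2 := by positivity
    have := Real.quadratic_le_exp_of_nonneg h0
    linarith
  calc (t * x) ^ 2 * Real.exp |t * x|
      = 4 * t ^ 2 / κ ^ 2 * ((κ * |x| / 2) ^ 2 * Real.exp |t * x|) := by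
        field_simp
        rw [sq_abs]
        ring
    _ ≤ 4 * t ^ 2 / κ ^ 2 * (2 * Real.exp (κ * |x| / 2) * Real.exp (κ * |x| / 2)) := by gcongr
    _ = 8 * t ^ 2 / κ ^ 2 * Real.exp (κ * |x|) := by
        rw [mul_assoc 2, ← Real.exp_add, add_halves]
        ring

theorem abs_le_inv_mul_exp {κ x : ℝ} (hκ : 0 < κ) : |x| ≤ κ⁻¹ * Real.exp (κ * |x|) := by
  have := Real.add_one_le_exp (κ * |x|)
  rw [← div_eq_inv_mul, le_div_iff₀ hκ]
  linarith

omit [IsProbabilityMeasure μ] in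
theorem integrable_of_integrable_exp {w : α → ℝ} {κ : ℝ} (hw : Measurable w) (hκ : 0 < κ)
    (hi : Integrable (fun z => Real.exp (κ * |w z|)) μ) : Integrable w μ :=
  (hi.const_mul κ⁻¹).mono' hw.aestronglyMeasurable
    (Filter.Eventually.of_forall fun _ => abs_le_inv_mul_exp hκ)

omit [IsProbabilityMeasure μ] in
theorem integrable_exp_mul_of_abs_le {w : α → ℝ} {κ t : ℝ} (hw : Measurable w) (hκ : 0 < κ)
    (ht : |t| ≤ κ / 2) (hi : Integrable (fun z => Real.exp (κ * |w z|)) μ) :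
    Integrable (fun z => Real.exp (t * w z)) μ := by
  refine hi.mono' (Measurable.aestronglyMeasurable (by fun_prop))
    (Filter.Eventually.of_forall fun z => ?_)
  rw [Real.norm_eq_abs, Real.abs_exp, Real.exp_le_exp]
  calc t * w z ≤ |t| * |w z| := by rw [← abs_mul]; exact le_abs_self _
    _ ≤ κ * |w z| := mul_le_mul_of_nonneg_right (by linarith) (abs_nonneg _)

theorem integral_exp_mul_le {w : α → ℝ} {κ c t : ℝ} (hw : Measurable w) (hκ : 0 < κ)
    (ht : |t| ≤ κ / 2) (hi : Integrable (fun z => Real.exp (κ * |w z|)) μ)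
    (hc : ∫ z, Real.exp (κ * |w z|) ∂μ ≤ c) (h0 : ∫ z, w z ∂μ = 0) :
    ∫ z, Real.exp (t * w z) ∂μ ≤ Real.exp (8 * t ^ 2 / κ ^ 2 * c) := by
  have hwi := integrable_of_integrable_exp hw hκ hi
  have h1 : Integrable (fun z => 1 + t * w z) μ := (integrable_const 1).add (hwi.const_mul t)
  have h2 := hi.const_mul (8 * t ^ 2 / κ ^ 2)
  calc ∫ z, Real.exp (t * w z) ∂μ
      ≤ ∫ z, (1 + t * w z + 8 * t ^ 2 / κ ^ 2 * Real.exp (κ * |w z|)) ∂μ :=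
        integral_mono (integrable_exp_mul_of_abs_le hw hκ ht hi) (h1.add h2)
          fun z => exp_mul_le_of_abs_le hκ ht
    _ = 1 + 8 * t ^ 2 / κ ^ 2 * ∫ z, Real.exp (κ * |w z|) ∂μ := by
        rw [integral_add h1 h2, integral_add (integrable_const 1) (hwi.const_mul t),
          integral_const_mul, integral_const_mul, h0]
        simp
    _ ≤ 1 + 8 * t ^ 2 / κ ^ 2 * c := by gcongr
    _ ≤ Real.exp (8 * t ^ 2 / κ ^ 2 * c) := by
        rw [add_comm]; exact Real.add_one_le_exp _

/-- With `|t| = κ / (2√n)` each factor of the moment generating function is at most `exp(2c / n)`,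
so the product of `N ≤ n` of them costs only the constant `exp(2c)`. -/
theorem measure_pi_sum_ge_le {w : α → ℝ} {κ c r t : ℝ} {N n : ℕ} (hw : Measurable w)
    (hκ : 0 < κ) (hn : 0 < n) (hN : N ≤ n) (ht : |t| = κ / (2 * √n))
    (hi : Integrable (fun z => Real.exp (κ * |w z|)) μ)
    (hc : ∫ z, Real.exp (κ * |w z|) ∂μ ≤ c) (h0 : ∫ z, w z ∂μ = 0) :
    (Measure.pi fun _ : Fin N => μ) {z | r ≤ t * ∑ i, w (z i)} ≤
      ENNReal.ofReal (Real.exp (2 * c - r)) := by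
  have hn' : (0 : ℝ) < n := Nat.cast_pos.2 hn
  have hsq : 1 ≤ √(n : ℝ) := Real.one_le_sqrt.2 (Nat.one_le_cast.2 hn)
  have hc0 : 0 ≤ c := (integral_nonneg fun z => (Real.exp_pos _).le).trans hc
  have ht' : |t| ≤ κ / 2 := by
    rw [ht]
    gcongr
    linarith
  have hprod : ∀ z : Fin N → α, Real.exp (t * ∑ i, w (z i)) = ∏ i, Real.exp (t * w (z i)) :=
    fun z => by rw [Finset.mul_sum, Real.exp_sum]
  have hint : Integrable (fun z : Fin N → α => Real.exp (1 * (t * ∑ i, w (z i))))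
      (Measure.pi fun _ : Fin N => μ) := by
    simp only [one_mul, hprod]
    exact Integrable.fintype_prod fun _ => integrable_exp_mul_of_abs_le hw hκ ht' hi
  have hch := measure_ge_le_exp_mul_mgf (μ := Measure.pi fun _ : Fin N => μ) r zero_le_one hint
  rw [← ofReal_measureReal]
  refine ENNReal.ofReal_le_ofReal (hch.trans ?_)
  have hm : mgf (fun z : Fin N → α => t * ∑ i, w (z i)) (Measure.pi fun _ : Fin N => μ) 1 ≤
      Real.exp (2 * c) := by
    simp only [mgf, one_mul, hprod]
    rw [integral_fintype_prod_eq_pow (ι := Fin N) (μ := μ) fun z => Real.exp (t * w z),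
      Fintype.card_fin]
    calc (∫ z, Real.exp (t * w z) ∂μ) ^ N
        ≤ (Real.exp (8 * t ^ 2 / κ ^ 2 * c)) ^ N :=
          pow_le_pow_left₀ (integral_nonneg fun z => (Real.exp_pos _).le)
            (integral_exp_mul_le hw hκ ht' hi hc h0) N
      _ = Real.exp (2 * c * (N / n)) := by
          rw [← Real.exp_nat_mul, ← sq_abs t, ht, div_pow, mul_pow, Real.sq_sqrt hn'.le]
          congr 1
          field_simp
          ring
      _ ≤ Real.exp (2 * c) := by
          rw [Real.exp_le_exp]
          have : (N : ℝ) / n ≤ 1 := (div_le_one hn').2 (Nat.cast_le.2 hN)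
          nlinarith
  calc Real.exp (-1 * r) * mgf (fun z : Fin N → α => t * ∑ i, w (z i))
        (Measure.pi fun _ : Fin N => μ) 1
      ≤ Real.exp (-1 * r) * Real.exp (2 * c) := by gcongr
    _ = Real.exp (2 * c - r) := by rw [← Real.exp_add]; ring_nf

theorem measure_pi_abs_sum_ge_le {w : α → ℝ} {κ c r : ℝ} {N n : ℕ} (hw : Measurable w)
    (hκ : 0 < κ) (hn : 0 < n) (hN : N ≤ n)
    (hi : Integrable (fun z => Real.exp (κ * |w z|)) μ)
    (hc : ∫ z, Real.exp (κ * |w z|) ∂μ ≤ c) (h0 : ∫ z, w z ∂μ = 0) :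
    (Measure.pi fun _ : Fin N => μ) {z | r ≤ κ / (2 * √n) * |∑ i, w (z i)|} ≤
      ENNReal.ofReal (2 * Real.exp (2 * c - r)) := by
  have hpos : 0 ≤ κ / (2 * √n) := by positivity
  have hsub : {z : Fin N → α | r ≤ κ / (2 * √n) * |∑ i, w (z i)|} ⊆
      {z | r ≤ κ / (2 * √n) * ∑ i, w (z i)} ∪ {z | r ≤ -(κ / (2 * √n)) * ∑ i, w (z i)} := by
    intro z hz
    rcases abs_choice (∑ i, w (z i)) with h | h
    · left
      simpa [h] using hz
    · right
      simpa [h] using hz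
  refine (measure_mono hsub).trans ((measure_union_le _ _).trans ?_)
  rw [two_mul (Real.exp _), ENNReal.ofReal_add (Real.exp_pos _).le (Real.exp_pos _).le]
  exact add_le_add (measure_pi_sum_ge_le hw hκ hn hN (abs_of_nonneg hpos) hi hc h0)
    (measure_pi_sum_ge_le hw hκ hn hN (by rw [abs_neg, abs_of_nonneg hpos]) hi hc h0)

/-- Conditioning on the `k`-th coordinate makes the remaining summands i.i.d. and centred; the bound
is uniform in the frozen value, so it survives integration over it. -/
theorem measure_pi_abs_sum_succAbove_ge_le {w : α → α → ℝ} {κ c r : ℝ} {N n : ℕ}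
    (hw : Measurable (Function.uncurry w)) (hκ : 0 < κ) (hn : 0 < n) (hN : N ≤ n)
    (hi : ∀ y, Integrable (fun z => Real.exp (κ * |w z y|)) μ)
    (hc : ∀ y, ∫ z, Real.exp (κ * |w z y|) ∂μ ≤ c) (h0 : ∀ y, ∫ z, w z y ∂μ = 0)
    (k : Fin (N + 1)) :
    (Measure.pi fun _ : Fin (N + 1) => μ)
        {z | r ≤ κ / (2 * √n) * |∑ j, w (z (k.succAbove j)) (z k)|} ≤
      ENNReal.ofReal (2 * Real.exp (2 * c - r)) := by
  set A : Set (α × (Fin N → α)) := {p | r ≤ κ / (2 * √n) * |∑ j, w (p.2 j) p.1|} with hA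
  have hAm : MeasurableSet A := by
    refine measurableSet_le measurable_const ?_
    refine Measurable.const_mul (Measurable.abs ?_) _
    refine Finset.measurable_sum _ fun j _ => ?_
    exact hw.comp (by fun_prop : Measurable fun p : α × (Fin N → α) => (p.2 j, p.1))
  have hmp := measurePreserving_piFinSuccAbove (fun _ : Fin (N + 1) => μ) k
  have hpre : {z : Fin (N + 1) → α | r ≤ κ / (2 * √n) * |∑ j, w (z (k.succAbove j)) (z k)|} =
      (MeasurableEquiv.piFinSuccAbove (fun _ : Fin (N + 1) => α) k) ⁻¹' A := rfl
  rw [hpre, hmp.measure_preimage hAm.nullMeasurableSet, Measure.prod_apply hAm]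
  calc ∫⁻ y, (Measure.pi fun _ : Fin N => μ) (Prod.mk y ⁻¹' A) ∂μ
      ≤ ∫⁻ _, ENNReal.ofReal (2 * Real.exp (2 * c - r)) ∂μ := by
        refine lintegral_mono fun y => ?_
        exact measure_pi_abs_sum_ge_le (hw.comp measurable_prodMk_right) hκ hn hN (hi y) (hc y)
          (h0 y)
    _ = ENNReal.ofReal (2 * Real.exp (2 * c - r)) := by simp

theorem measure_pi_coord_ge_le {f : α → ℝ} {c L : ℝ} {N : ℕ}
    (hi : Integrable (fun z => Real.exp (f z)) μ) (hc : ∫ z, Real.exp (f z) ∂μ ≤ c)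
    (hf : Measurable f) (k : Fin N) :
    (Measure.pi fun _ : Fin N => μ) {z | L ≤ f (z k)} ≤
      ENNReal.ofReal (c * Real.exp (-L)) := by
  have hmp := measurePreserving_eval (fun _ : Fin N => μ) k
  have hm : MeasurableSet {y | L ≤ f y} := measurableSet_le measurable_const hf
  have hpre : {z : Fin N → α | L ≤ f (z k)} = Function.eval k ⁻¹' {y | L ≤ f y} := rfl
  rw [hpre, hmp.measure_preimage hm.nullMeasurableSet, ← ofReal_measureReal]
  refine ENNReal.ofReal_le_ofReal ?_
  have := measure_ge_le_exp_mul_mgf (μ := μ) (X := f) L zero_le_one (by simpa using hi)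
  refine this.trans ?_
  simp only [mgf, one_mul, neg_mul]
  rw [mul_comm]
  gcongr

end Concentration
-- Deviation of one V-statistic
section VStatistic

variable {α : Type*} [MeasurableSpace α] {μ : Measure α} [IsProbabilityMeasure μ]

/-- `f` is measurable and `E exp(2 s f²) ≤ σ`. -/
structure HasExpSq (μ : Measure α) (s σ : ℝ) (f : α → ℝ) : Prop where
  measurable : Measurable f
  integrable : Integrable (fun z => Real.exp (2 * s * f z ^ 2)) μ
  integral_le : ∫ z, Real.exp (2 * s * f z ^ 2) ∂μ ≤ σ

/-- The bound `1 + σ / s` for `E (1 + f² + g²)`. -/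
def momentBound (s σ : ℝ) : ℝ := 1 + σ / s

/-- The bound for the exponential moments of the centred summands. -/
def expBound (s σ : ℝ) : ℝ := Real.exp (s * (1 + momentBound s σ)) * σ

/-- The constant in the deviation bound for the V-statistic. -/
def devBound (s σ : ℝ) : ℝ :=
  4 / s * (1 + 1 / s) + 4 * momentBound s σ / s + momentBound s σ ^ 2

variable {s σ : ℝ} {f g : α → ℝ}

namespace HasExpSq

omit [IsProbabilityMeasure μ] in
theorem integrable_sq (hf : HasExpSq μ s σ f) (hs : 0 < s) :
    Integrable (fun z => f z ^ 2) μ := by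
  have hm := hf.measurable
  refine (hf.integrable.const_mul (2 * s)⁻¹).mono' (Measurable.aestronglyMeasurable (by fun_prop))
    (Filter.Eventually.of_forall fun z => ?_)
  have := Real.add_one_le_exp (2 * s * f z ^ 2)
  rw [Real.norm_eq_abs, abs_of_nonneg (sq_nonneg _), ← div_eq_inv_mul, le_div_iff₀ (by positivity)]
  linarith

omit [IsProbabilityMeasure μ] in
theorem integral_sq_le (hf : HasExpSq μ s σ f) (hs : 0 < s) :
    ∫ z, f z ^ 2 ∂μ ≤ σ / (2 * s) := by
  rw [le_div_iff₀ (by positivity), mul_comm, ← integral_const_mul]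
  refine le_trans (integral_mono ((hf.integrable_sq hs).const_mul _) hf.integrable fun z => ?_)
    hf.integral_le
  have := Real.add_one_le_exp (2 * s * f z ^ 2)
  dsimp only
  linarith

theorem integrable_one_add (hf : HasExpSq μ s σ f) (hg : HasExpSq μ s σ g) (hs : 0 < s) :
    Integrable (fun z => 1 + f z ^ 2 + g z ^ 2) μ :=
  ((integrable_const 1).add (hf.integrable_sq hs)).add (hg.integrable_sq hs)

theorem integral_one_add_le (hf : HasExpSq μ s σ f) (hg : HasExpSq μ s σ g) (hs : 0 < s) :
    ∫ z, (1 + f z ^ 2 + g z ^ 2) ∂μ ≤ momentBound s σ := by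
  have h1 := hf.integral_sq_le hs
  have h2 := hg.integral_sq_le hs
  have hi : Integrable (fun z => 1 + f z ^ 2) μ := (integrable_const 1).add (hf.integrable_sq hs)
  rw [integral_add hi (hg.integrable_sq hs),
    integral_add (integrable_const 1) (hf.integrable_sq hs), momentBound]
  have h3 : σ / s = σ / (2 * s) + σ / (2 * s) := by field_simp; ring
  simp only [integral_const, probReal_univ, smul_eq_mul, mul_one]
  linarith

theorem exp_add_le (x y : ℝ) :
    Real.exp (s * (x ^ 2 + y ^ 2)) ≤
      (Real.exp (2 * s * x ^ 2) + Real.exp (2 * s * y ^ 2)) / 2 := by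
  have h1 : ∀ x, Real.exp (2 * s * x ^ 2) = Real.exp (s * x ^ 2) ^ 2 := fun x => by
    rw [← Real.exp_nat_mul]; push_cast; ring_nf
  rw [h1, h1, mul_add, Real.exp_add]
  nlinarith [sq_nonneg (Real.exp (s * x ^ 2) - Real.exp (s * y ^ 2))]

omit [IsProbabilityMeasure μ] in
theorem integrable_exp_add (hf : HasExpSq μ s σ f) (hg : HasExpSq μ s σ g) :
    Integrable (fun z => Real.exp (s * (f z ^ 2 + g z ^ 2))) μ := by
  have hfm := hf.measurable
  have hgm := hg.measurable
  refine ((hf.integrable.add hg.integrable).div_const 2).mono'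
    (Measurable.aestronglyMeasurable (by fun_prop)) (Filter.Eventually.of_forall fun z => ?_)
  rw [Real.norm_eq_abs, Real.abs_exp]
  exact exp_add_le _ _

omit [IsProbabilityMeasure μ] in
theorem integral_exp_add_le (hf : HasExpSq μ s σ f) (hg : HasExpSq μ s σ g) :
    ∫ z, Real.exp (s * (f z ^ 2 + g z ^ 2)) ∂μ ≤ σ := by
  refine (integral_mono (hf.integrable_exp_add hg)
    ((hf.integrable.add hg.integrable).div_const 2) fun z => exp_add_le _ _).trans ?_
  have h : ∫ z, (Real.exp (2 * s * f z ^ 2) + Real.exp (2 * s * g z ^ 2)) / 2 ∂μ =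
      ((∫ z, Real.exp (2 * s * f z ^ 2) ∂μ) + ∫ z, Real.exp (2 * s * g z ^ 2) ∂μ) / 2 := by
    rw [integral_div, integral_add hf.integrable hg.integrable]
  refine h.trans_le ?_
  linarith [hf.integral_le, hg.integral_le]

omit [IsProbabilityMeasure μ] in
theorem integrable_exp_abs (hf : HasExpSq μ s σ f) (hg : HasExpSq μ s σ g) {w : α → ℝ} {κ : ℝ}
    (hwm : Measurable w)
    (hw : ∀ z, κ * |w z| ≤ s * (1 + momentBound s σ) + s * (f z ^ 2 + g z ^ 2)) :
    Integrable (fun z => Real.exp (κ * |w z|)) μ := by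
  refine ((hf.integrable_exp_add hg).const_mul (Real.exp (s * (1 + momentBound s σ)))).mono'
    (Measurable.aestronglyMeasurable (by fun_prop)) (Filter.Eventually.of_forall fun z => ?_)
  rw [Real.norm_eq_abs, Real.abs_exp, ← Real.exp_add, Real.exp_le_exp]
  exact hw z

omit [IsProbabilityMeasure μ] in
theorem integral_exp_abs_le (hf : HasExpSq μ s σ f) (hg : HasExpSq μ s σ g) {w : α → ℝ} {κ : ℝ}
    (hwm : Measurable w)
    (hw : ∀ z, κ * |w z| ≤ s * (1 + momentBound s σ) + s * (f z ^ 2 + g z ^ 2)) :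
    ∫ z, Real.exp (κ * |w z|) ∂μ ≤ expBound s σ := by
  refine (integral_mono (hf.integrable_exp_abs hg hwm hw)
    ((hf.integrable_exp_add hg).const_mul (Real.exp (s * (1 + momentBound s σ)))) fun z => ?_).trans
    ?_
  · dsimp only
    rw [← Real.exp_add, Real.exp_le_exp]
    exact hw z
  · rw [integral_const_mul, expBound]
    have := hf.integral_exp_add_le hg
    gcongr

end HasExpSq

theorem one_add_mul_abs_le (x y : ℝ) : (1 + |x|) * |y| ≤ 1 + x ^ 2 + y ^ 2 := by
  rw [← sq_abs x, ← sq_abs y]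
  nlinarith [sq_nonneg (1 + |x| - |y|), sq_nonneg (1 - |x|), sq_nonneg |y|]

variable {E : Type*} [NormedAddCommGroup E] [MeasurableSpace E] [BorelSpace E]
  [SecondCountableTopology E] {y : α → E} {a b : α → ℝ}

-- Separates the two points through `‖y - y'‖ ≤ (1 + ‖y'‖)(1 + ‖y‖)`. This is why dividing by `1 +
-- ‖y'‖` gives moment bounds uniform in the second point.
omit [MeasurableSpace α] [MeasurableSpace E] [BorelSpace E] [SecondCountableTopology E] in
theorem norm_sub_mul_abs_le (z z' : α) :
    |‖y z - y z'‖ * a z| ≤ (1 + ‖y z'‖) * (1 + ‖y z‖ ^ 2 + a z ^ 2) := by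
  have h1 := one_add_mul_abs_le ‖y z‖ (a z)
  rw [abs_norm] at h1
  rw [abs_mul, abs_norm]
  calc ‖y z - y z'‖ * |a z| ≤ ((1 + ‖y z'‖) * (1 + ‖y z‖)) * |a z| := by
        gcongr
        nlinarith [norm_sub_le (y z) (y z'), norm_nonneg (y z), norm_nonneg (y z')]
    _ ≤ _ := by
        rw [mul_assoc]
        gcongr

/-- The conditional mean of `‖y - y'‖ a` given the second point. -/
def condMean (μ : Measure α) (y : α → E) (a : α → ℝ) (z' : α) : ℝ :=
  ∫ z, ‖y z - y z'‖ * a z ∂μ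

theorem measurable_condMean (hy : Measurable y) (ha : Measurable a) :
    Measurable (condMean μ y a) := by
  have : StronglyMeasurable (Function.uncurry fun z' z => ‖y z - y z'‖ * a z) := by
    refine Measurable.stronglyMeasurable ?_
    unfold Function.uncurry
    fun_prop
  exact this.integral_prod_right.measurable

omit [SecondCountableTopology E] in
theorem integrable_norm_sub_mul_left (hs : 0 < s) (hym : Measurable y)
    (hy : HasExpSq μ s σ fun z => ‖y z‖) (ha : HasExpSq μ s σ a) (z' : α) :
    Integrable (fun z => ‖y z - y z'‖ * a z) μ := by
  have ham := ha.measurable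
  exact ((hy.integrable_one_add ha hs).const_mul (1 + ‖y z'‖)).mono'
    (Measurable.aestronglyMeasurable (by fun_prop))
    (Filter.Eventually.of_forall fun z => norm_sub_mul_abs_le z z')

omit [SecondCountableTopology E] in
theorem abs_condMean_le (hs : 0 < s) (hym : Measurable y)
    (hy : HasExpSq μ s σ fun z => ‖y z‖) (ha : HasExpSq μ s σ a) (z' : α) :
    |condMean μ y a z'| ≤ momentBound s σ * (1 + ‖y z'‖) := by
  refine abs_integral_le_integral_abs.trans ?_
  refine (integral_mono (integrable_norm_sub_mul_left hs hym hy ha z').abs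
    ((hy.integrable_one_add ha hs).const_mul (1 + ‖y z'‖))
    fun z => norm_sub_mul_abs_le z z').trans ?_
  rw [integral_const_mul, mul_comm]
  gcongr
  exact hy.integral_one_add_le ha hs

omit [SecondCountableTopology E] in
theorem abs_mul_condMean_le (hs : 0 < s) (hσ : 0 < σ) (hym : Measurable y)
    (hy : HasExpSq μ s σ fun z => ‖y z‖) (ha : HasExpSq μ s σ a) (z : α) :
    |b z * condMean μ y a z| ≤ momentBound s σ * (1 + ‖y z‖ ^ 2 + b z ^ 2) := by
  have h1 := one_add_mul_abs_le ‖y z‖ (b z)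
  have hK : 0 ≤ momentBound s σ := by unfold momentBound; positivity
  rw [abs_norm] at h1
  rw [abs_mul]
  calc |b z| * |condMean μ y a z| ≤ |b z| * (momentBound s σ * (1 + ‖y z‖)) := by
        gcongr
        exact abs_condMean_le hs hym hy ha z
    _ = momentBound s σ * ((1 + ‖y z‖) * |b z|) := by ring
    _ ≤ _ := by gcongr

/-- The centred and normalised kernel of the inner sum. -/
def innerKernel (μ : Measure α) (y : α → E) (a : α → ℝ) (z z' : α) : ℝ :=
  (‖y z - y z'‖ * a z - condMean μ y a z') / (1 + ‖y z'‖)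

theorem measurable_innerKernel (hy : Measurable y) (ha : Measurable a) :
    Measurable (Function.uncurry (innerKernel μ y a)) := by
  have := measurable_condMean (μ := μ) hy ha
  unfold Function.uncurry innerKernel
  fun_prop

omit [SecondCountableTopology E] in
theorem mul_abs_innerKernel_le (hs : 0 < s) (hym : Measurable y)
    (hy : HasExpSq μ s σ fun z => ‖y z‖) (ha : HasExpSq μ s σ a) (z z' : α) :
    s * |innerKernel μ y a z z'| ≤
      s * (1 + momentBound s σ) + s * (‖y z‖ ^ 2 + a z ^ 2) := by
  rw [← mul_add]
  gcongr
  have hpos : 0 < 1 + ‖y z'‖ := by positivity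
  rw [innerKernel, abs_div, abs_of_pos hpos, div_le_iff₀ hpos]
  calc _ ≤ |‖y z - y z'‖ * a z| + |condMean μ y a z'| := abs_sub _ _
    _ ≤ (1 + ‖y z'‖) * (1 + ‖y z‖ ^ 2 + a z ^ 2) + momentBound s σ * (1 + ‖y z'‖) :=
        add_le_add (norm_sub_mul_abs_le z z') (abs_condMean_le hs hym hy ha z')
    _ = _ := by ring

omit [SecondCountableTopology E] in
theorem integral_innerKernel (hs : 0 < s) (hym : Measurable y)
    (hy : HasExpSq μ s σ fun z => ‖y z‖) (ha : HasExpSq μ s σ a) (z' : α) :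
    ∫ z, innerKernel μ y a z z' ∂μ = 0 := by
  unfold innerKernel
  rw [integral_div, integral_sub (integrable_norm_sub_mul_left hs hym hy ha z')
    (integrable_const _)]
  simp [condMean]

/-- The V-statistic `n⁻² ∑_{j,k} ‖y_j - y_k‖ a_j b_k`. -/
def vStat {n : ℕ} (y : α → E) (a b : α → ℝ) (z : Fin n → α) : ℝ :=
  (1 / (n : ℝ) ^ 2) * ∑ j, ∑ k, ‖y (z j) - y (z k)‖ * (a (z j) * b (z k))

-- A Hoeffding-type decomposition. The diagonal terms vanish because `‖y_k - y_k‖ = 0`, so each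
-- inner sum has only `N` terms; the last summand is the resulting bias.
omit [IsProbabilityMeasure μ] [MeasurableSpace E] [BorelSpace E] [SecondCountableTopology E] in
theorem sq_mul_vStat_sub (N : ℕ) (θ : ℝ) (z : Fin (N + 1) → α) :
    ((N : ℝ) + 1) ^ 2 * (vStat y a b z - θ) =
      ∑ k, b (z k) * (1 + ‖y (z k)‖) * ∑ j, innerKernel μ y a (z (k.succAbove j)) (z k) +
        N * ∑ k, (b (z k) * condMean μ y a (z k) - θ) - (N + 1) * θ := by
  have h1 : ∀ k, b (z k) * (1 + ‖y (z k)‖) *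
      ∑ j, innerKernel μ y a (z (k.succAbove j)) (z k) =
      ∑ j, ‖y (z j) - y (z k)‖ * (a (z j) * b (z k)) -
        N * (b (z k) * condMean μ y a (z k)) := fun k => by
    have hpos : (1 + ‖y (z k)‖) ≠ 0 := by positivity
    simp only [innerKernel]
    rw [← Finset.sum_div, Finset.sum_sub_distrib, Fin.sum_univ_succAbove _ k]
    simp only [sub_self, norm_zero, zero_mul, zero_add, Finset.sum_const, Finset.card_univ,
      Fintype.card_fin, nsmul_eq_mul]
    rw [mul_assoc, mul_div_cancel₀ _ hpos, mul_sub, Finset.mul_sum]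
    congr 1
    · exact Finset.sum_congr rfl fun j _ => by ring
    · ring
  simp only [h1, Finset.sum_sub_distrib, ← Finset.mul_sum]
  rw [vStat, Finset.sum_comm]
  push_cast
  simp only [Finset.sum_const, Finset.card_univ, Fintype.card_fin, nsmul_eq_mul]
  push_cast
  have : (N : ℝ) + 1 ≠ 0 := by positivity
  field_simp
  ring

omit [IsProbabilityMeasure μ] [MeasurableSpace E] [BorelSpace E] [SecondCountableTopology E] in
theorem abs_vStat_sub_le {N : ℕ} {θ L K c : ℝ} {z : Fin (N + 1) → α} (hs : 0 < s) (hK : 0 < K)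
    (hL1 : 1 ≤ L) (hLc : 2 * c ≤ L) (hθ : |θ| ≤ K ^ 2)
    (h1 : ∀ k : Fin (N + 1), s / (2 * √((N + 1 : ℕ) : ℝ)) *
      |∑ j, innerKernel μ y a (z (k.succAbove j)) (z k)| < 2 * c + L)
    (h2 : s / K / (2 * √((N + 1 : ℕ) : ℝ)) *
      |∑ k, (b (z k) * condMean μ y a (z k) - θ)| < 2 * c + L)
    (h3 : ∀ k, s * (‖y (z k)‖ ^ 2 + b (z k) ^ 2) < L) :
    |vStat y a b z - θ| ≤
      (4 / s * (1 + 1 / s) + 4 * K / s + K ^ 2) * L ^ 2 / √((N + 1 : ℕ) : ℝ) := by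
  set n : ℝ := ((N + 1 : ℕ) : ℝ) with hn
  have hn1 : 1 ≤ n := by rw [hn]; push_cast; linarith [Nat.cast_nonneg (α := ℝ) N]
  have hr1 : 1 ≤ √n := Real.one_le_sqrt.2 hn1
  have hr : 0 < √n := by linarith
  have hrr : √n * √n = n := Real.mul_self_sqrt (by linarith)
  have hL0 : 0 < L := by linarith
  -- The bound `2√n (2c + L) / s` becomes `4√n L / s` by `2c ≤ L`.
  have e1 : ∀ k : Fin (N + 1), |∑ j, innerKernel μ y a (z (k.succAbove j)) (z k)| ≤
      4 * √n * L / s := fun k => by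
    have := h1 k
    rw [div_mul_eq_mul_div, div_lt_iff₀ (by positivity)] at this
    rw [le_div_iff₀ hs]
    nlinarith
  have e2 : |∑ k, (b (z k) * condMean μ y a (z k) - θ)| ≤ 4 * √n * L * K / s := by
    rw [div_div, div_mul_eq_mul_div, div_lt_iff₀ (by positivity)] at h2
    rw [le_div_iff₀ hs]
    nlinarith [mul_pos hr hK]
  have e3 : ∀ k, |b (z k) * (1 + ‖y (z k)‖)| ≤ 1 + L / s := fun k => by
    have h4 := one_add_mul_abs_le ‖y (z k)‖ (b (z k))
    have h5 : ‖y (z k)‖ ^ 2 + b (z k) ^ 2 ≤ L / s := by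
      rw [le_div_iff₀ hs, mul_comm]; exact (h3 k).le
    rw [abs_mul, abs_of_pos (show 0 < 1 + ‖y (z k)‖ by positivity), mul_comm]
    rw [abs_norm] at h4
    linarith
  have key := sq_mul_vStat_sub (μ := μ) (y := y) (a := a) (b := b) N θ z
  have hnN : (N : ℝ) + 1 = n := by rw [hn]; push_cast; ring
  rw [hnN] at key
  have b1 : |∑ k, b (z k) * (1 + ‖y (z k)‖) *
      ∑ j, innerKernel μ y a (z (k.succAbove j)) (z k)| ≤
      n * ((1 + L / s) * (4 * √n * L / s)) := by
    refine (Finset.abs_sum_le_sum_abs _ _).trans ?_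
    refine (Finset.sum_le_card_nsmul _ _ ((1 + L / s) * (4 * √n * L / s)) fun k _ => ?_).trans ?_
    · rw [abs_mul]
      exact mul_le_mul (e3 k) (e1 k) (abs_nonneg _) (by positivity)
    · simp [hn]
  have b2 : |(N : ℝ) * ∑ k, (b (z k) * condMean μ y a (z k) - θ)| ≤
      n * (4 * √n * L * K / s) := by
    rw [abs_mul, abs_of_nonneg (Nat.cast_nonneg N)]
    exact mul_le_mul (by linarith) e2 (abs_nonneg _) (by linarith)
  have b3 : |n * θ| ≤ n * K ^ 2 := by
    rw [abs_mul, abs_of_pos (by linarith : 0 < n)]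
    gcongr
  have b4 : n ^ 2 * |vStat y a b z - θ| ≤ n * ((1 + L / s) * (4 * √n * L / s)) +
      n * (4 * √n * L * K / s) + n * K ^ 2 := by
    rw [← abs_of_pos (show 0 < n ^ 2 by positivity), ← abs_mul, key]
    refine (abs_sub _ _).trans ?_
    have := abs_add_le (∑ k, b (z k) * (1 + ‖y (z k)‖) *
      ∑ j, innerKernel μ y a (z (k.succAbove j)) (z k))
      ((N : ℝ) * ∑ k, (b (z k) * condMean μ y a (z k) - θ))
    linarith
  have b5 : n * ((1 + L / s) * (4 * √n * L / s)) + n * (4 * √n * L * K / s) + n * K ^ 2 ≤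
      n * √n * ((4 / s * (1 + 1 / s) + 4 * K / s + K ^ 2) * L ^ 2) := by
    have hL2 : 1 ≤ L ^ 2 := one_le_pow₀ hL1
    have hLL : L ≤ L ^ 2 := by nlinarith
    have c1 : (1 + L / s) * (4 * √n * L / s) ≤ √n * (4 / s * (1 + 1 / s) * L ^ 2) := by
      have : (1 + L / s) ≤ L * (1 + 1 / s) := by
        rw [mul_add, mul_one_div, mul_one]; linarith
      calc (1 + L / s) * (4 * √n * L / s) ≤ L * (1 + 1 / s) * (4 * √n * L / s) := by gcongr
        _ = _ := by ring
    have c2 : 4 * √n * L * K / s ≤ √n * (4 * K / s * L ^ 2) := by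
      calc 4 * √n * L * K / s ≤ 4 * √n * L ^ 2 * K / s := by gcongr
        _ = _ := by ring
    have c3 : K ^ 2 ≤ √n * (K ^ 2 * L ^ 2) := by
      have : 1 * 1 ≤ √n * L ^ 2 := mul_le_mul hr1 hL2 zero_le_one hr.le
      nlinarith [sq_nonneg K]
    have : 0 < n := by linarith
    calc _ = n * ((1 + L / s) * (4 * √n * L / s) + 4 * √n * L * K / s + K ^ 2) := by ring
      _ ≤ n * (√n * (4 / s * (1 + 1 / s) * L ^ 2) + √n * (4 * K / s * L ^ 2) +
          √n * (K ^ 2 * L ^ 2)) := by gcongr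
      _ = _ := by ring
  rw [le_div_iff₀ hr]
  have hn0 : 0 < n * √n := by positivity
  refine le_of_mul_le_mul_left ?_ hn0
  calc n * √n * (|vStat y a b z - θ| * √n) = n * (√n * √n) * |vStat y a b z - θ| := by ring
    _ = n ^ 2 * |vStat y a b z - θ| := by rw [hrr]; ring
    _ ≤ _ := b4.trans b5

omit [MeasurableSpace E] [BorelSpace E] [SecondCountableTopology E] in
theorem integral_prod_eq_integral_mul_condMean
    (hi : Integrable (fun p : α × α => ‖y p.1 - y p.2‖ * (a p.1 * b p.2)) (μ.prod μ)) :
    ∫ p, ‖y p.1 - y p.2‖ * (a p.1 * b p.2) ∂(μ.prod μ) = ∫ z, b z * condMean μ y a z ∂μ := by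
  rw [integral_prod_symm _ hi]
  refine integral_congr_ae (Filter.Eventually.of_forall fun z' => ?_)
  simp only [condMean, ← integral_const_mul]
  refine integral_congr_ae (Filter.Eventually.of_forall fun z => ?_)
  dsimp only
  ring

/-- A union bound over the three ways the hypotheses of `abs_vStat_sub_le` can fail: a large inner
sum, a large sum of conditional means, or a large weight. -/
theorem measure_pi_abs_vStat_sub_gt_le (hs : 0 < s) (hσ : 0 < σ) (hym : Measurable y)
    (hy : HasExpSq μ s σ fun z => ‖y z‖) (ha : HasExpSq μ s σ a) (hb : HasExpSq μ s σ b)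
    {n : ℕ} (hn : 0 < n) {L : ℝ} (hL1 : 1 ≤ L) (hLc : 2 * expBound s σ ≤ L) :
    (Measure.pi fun _ : Fin n => μ)
        {z | devBound s σ * L ^ 2 / √n <
          |vStat y a b z - ∫ p, b p * condMean μ y a p ∂μ|} ≤
      ENNReal.ofReal ((4 + σ) * n * Real.exp (-L)) := by
  obtain ⟨N, rfl⟩ : ∃ N, n = N + 1 := ⟨n - 1, by omega⟩
  have ham := ha.measurable
  have hbm := hb.measurable
  have hcm := measurable_condMean (μ := μ) hym ham
  set K := momentBound s σ with hKdef
  set c := expBound s σ with hcdef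
  have hK : 1 ≤ K := by
    have : 0 < σ / s := by positivity
    rw [hKdef, momentBound]; linarith
  set θ := ∫ p, b p * condMean μ y a p ∂μ with hθdef
  have hbi : Integrable (fun p => b p * condMean μ y a p) μ :=
    ((hy.integrable_one_add hb hs).const_mul K).mono'
      (Measurable.aestronglyMeasurable (by fun_prop))
      (Filter.Eventually.of_forall fun z => abs_mul_condMean_le hs hσ hym hy ha z)
  have hθ : |θ| ≤ K ^ 2 := by
    refine abs_integral_le_integral_abs.trans ((integral_mono hbi.abs
      ((hy.integrable_one_add hb hs).const_mul K)
      fun z => abs_mul_condMean_le hs hσ hym hy ha z).trans ?_)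
    rw [integral_const_mul, sq]
    gcongr
    exact hy.integral_one_add_le hb hs
  have hv : ∀ z, s / K * |b z * condMean μ y a z - θ| ≤
      s * (1 + K) + s * (‖y z‖ ^ 2 + b z ^ 2) := fun z => by
    have h1 := abs_mul_condMean_le (b := b) hs hσ hym hy ha z
    rw [div_mul_eq_mul_div, div_le_iff₀ (by linarith)]
    calc s * |b z * condMean μ y a z - θ|
        ≤ s * (K * (1 + ‖y z‖ ^ 2 + b z ^ 2) + K ^ 2) := by
          gcongr
          exact (abs_sub _ _).trans (add_le_add h1 hθ)
      _ = _ := by ring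
  have hvm : Measurable fun z => b z * condMean μ y a z - θ := by fun_prop
  have hv0 : ∫ z, (b z * condMean μ y a z - θ) ∂μ = 0 := by
    rw [integral_sub hbi (integrable_const _)]
    simp [hθdef]
  -- The shift by `2 * c` cancels the constant in the Chernoff bound, leaving `exp (-L)`.
  set r := 2 * c + L with hr
  set B1 : Fin (N + 1) → Set (Fin (N + 1) → α) := fun k =>
    {z | r ≤ s / (2 * √((N + 1 : ℕ) : ℝ)) *
      |∑ j, innerKernel μ y a (z (k.succAbove j)) (z k)|}
  set B2 : Set (Fin (N + 1) → α) := {z | r ≤ s / K / (2 * √((N + 1 : ℕ) : ℝ)) *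
      |∑ k, (b (z k) * condMean μ y a (z k) - θ)|}
  set B3 : Fin (N + 1) → Set (Fin (N + 1) → α) := fun k =>
    {z | L ≤ s * (‖y (z k)‖ ^ 2 + b (z k) ^ 2)}
  have hsub : {z : Fin (N + 1) → α | devBound s σ * L ^ 2 / √((N + 1 : ℕ) : ℝ) <
      |vStat y a b z - θ|} ⊆ (⋃ k, B1 k) ∪ B2 ∪ ⋃ k, B3 k := by
    intro z hz
    by_contra hcon
    simp only [Set.mem_union, Set.mem_iUnion, not_or, not_exists, B1, B2, B3,
      Set.mem_ofPred_eq, not_le] at hcon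
    obtain ⟨⟨g1, g2⟩, g3⟩ := hcon
    exact absurd hz (not_lt.2 (abs_vStat_sub_le hs (by linarith) hL1 hLc hθ g1 g2 g3))
  have m1 : ∀ k, (Measure.pi fun _ : Fin (N + 1) => μ) (B1 k) ≤
      ENNReal.ofReal (2 * Real.exp (2 * c - r)) := fun k =>
    measure_pi_abs_sum_succAbove_ge_le (measurable_innerKernel hym ham) hs N.succ_pos
      (Nat.le_succ N)
      (fun z' => hy.integrable_exp_abs ha
        ((measurable_innerKernel hym ham).comp measurable_prodMk_right)
        fun z => mul_abs_innerKernel_le hs hym hy ha z z')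
      (fun z' => hy.integral_exp_abs_le ha
        ((measurable_innerKernel hym ham).comp measurable_prodMk_right)
        fun z => mul_abs_innerKernel_le hs hym hy ha z z')
      (integral_innerKernel hs hym hy ha) k
  have m2 : (Measure.pi fun _ : Fin (N + 1) => μ) B2 ≤
      ENNReal.ofReal (2 * Real.exp (2 * c - r)) :=
    measure_pi_abs_sum_ge_le hvm (by positivity) N.succ_pos le_rfl
      (hy.integrable_exp_abs hb hvm hv) (hy.integral_exp_abs_le hb hvm hv) hv0
  have m3 : ∀ k, (Measure.pi fun _ : Fin (N + 1) => μ) (B3 k) ≤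
      ENNReal.ofReal (σ * Real.exp (-L)) := fun k =>
    measure_pi_coord_ge_le (hy.integrable_exp_add hb) (hy.integral_exp_add_le hb)
      (by fun_prop) k
  have hexp : Real.exp (2 * c - r) = Real.exp (-L) := by rw [hr]; ring_nf
  rw [hexp] at m1 m2
  have s1 : (Measure.pi fun _ : Fin (N + 1) => μ) (⋃ k, B1 k) ≤
      ENNReal.ofReal ((N + 1 : ℕ) * (2 * Real.exp (-L))) := by
    refine (measure_iUnion_fintype_le _ _).trans ((Finset.sum_le_card_nsmul _ _ _
      fun k _ => m1 k).trans_eq ?_)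
    rw [ENNReal.ofReal_mul (p := ((N + 1 : ℕ) : ℝ)) (by positivity), ENNReal.ofReal_natCast]
    simp
  have s3 : (Measure.pi fun _ : Fin (N + 1) => μ) (⋃ k, B3 k) ≤
      ENNReal.ofReal ((N + 1 : ℕ) * (σ * Real.exp (-L))) := by
    refine (measure_iUnion_fintype_le _ _).trans ((Finset.sum_le_card_nsmul _ _ _
      fun k _ => m3 k).trans_eq ?_)
    rw [ENNReal.ofReal_mul (p := ((N + 1 : ℕ) : ℝ)) (by positivity), ENNReal.ofReal_natCast]
    simp
  refine (measure_mono hsub).trans ((measure_union_le _ _).trans ((add_le_add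
    ((measure_union_le _ _).trans (add_le_add s1 m2)) s3).trans ?_))
  have he := Real.exp_pos (-L)
  rw [← ENNReal.ofReal_add (by positivity) (by positivity),
    ← ENNReal.ofReal_add (by positivity) (by positivity)]
  refine ENNReal.ofReal_le_ofReal ?_
  -- The total is `(2n + 2 + σ n) exp(-L)`, and `2 ≤ 2n`.
  have hN1 : (1 : ℝ) ≤ ((N + 1 : ℕ) : ℝ) := by exact_mod_cast N.succ_pos
  nlinarith [mul_le_mul_of_nonneg_right hN1 he.le]

end VStatistic
-- Union bound over the entries and choice of constants
section Assembly

theorem coordOp_mem_span {H : Type*} [NormedAddCommGroup H] [InnerProductSpace ℝ H] (φ : ℕ → H)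
    (m : ℕ) (A : ℕ → ℕ → ℝ) (x : H) :
    coordOp φ m A x ∈ Submodule.span ℝ (Set.range fun i : Fin m => φ i) := by
  rw [coordOp_apply]
  refine Submodule.neg_mem _ (Submodule.sum_mem _ fun b hb => Submodule.smul_mem _ _ ?_)
  exact Submodule.subset_span ⟨⟨b, Finset.mem_range.1 hb⟩, rfl⟩

variable {Ω : Type*} [MeasurableSpace Ω] {P : Measure Ω} [IsProbabilityMeasure P] {q : ℕ}
variable {X : Ω → L2I} {Y : Ω → EuclideanSpace ℝ (Fin q)}

omit [IsProbabilityMeasure P] in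
theorem HasExpSq.of_lintegral {α : Type*} [MeasurableSpace α] {Z : Ω → α} (hZ : Measurable Z)
    {f : α → ℝ} (hf : Measurable f) {s σ : ℝ} (hσ : 0 ≤ σ)
    (h : ∫⁻ ω, ENNReal.ofReal (Real.exp (2 * s * f (Z ω) ^ 2)) ∂P ≤ ENNReal.ofReal σ) :
    HasExpSq (P.map Z) s σ f := by
  have hm : Measurable fun z => Real.exp (2 * s * f z ^ 2) := by fun_prop
  have h' : ∫⁻ z, ENNReal.ofReal (Real.exp (2 * s * f z ^ 2)) ∂(P.map Z) ≤ ENNReal.ofReal σ := by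
    rwa [lintegral_map hm.ennreal_ofReal hZ]
  have h0 : 0 ≤ᵐ[P.map Z] fun z => Real.exp (2 * s * f z ^ 2) :=
    Filter.Eventually.of_forall fun z => (Real.exp_pos _).le
  refine ⟨hf, ⟨hm.aestronglyMeasurable, ?_⟩, ?_⟩
  · rw [hasFiniteIntegral_iff_ofReal h0]
    exact h'.trans_lt ENNReal.ofReal_lt_top
  · rw [integral_eq_lintegral_of_nonneg_ae h0 hm.aestronglyMeasurable]
    exact ENNReal.toReal_le_of_le_ofReal hσ h'

theorem measurable_inner_fst (φ : L2I) :
    Measurable fun z : L2I × EuclideanSpace ℝ (Fin q) => (inner ℝ z.1 φ : ℝ) :=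
  (show Continuous fun x : L2I => (inner ℝ x φ : ℝ) by fun_prop).measurable.comp measurable_fst

theorem mddEntry_eq_integral_condMean (hXm : Measurable X) (hYm : Measurable Y)
    (hX : MemLp X 2 P) (hY : MemLp Y 2 P) (φ : ℕ → L2I) (a b : ℕ) :
    mddEntry P X Y φ a b =
      ∫ z, inner ℝ z.1 (φ b) * condMean (P.map fun ω => (X ω, Y ω)) Prod.snd
        (fun z => inner ℝ z.1 (φ a)) z ∂(P.map fun ω => (X ω, Y ω)) := by
  have hZ : Measurable fun ω => (X ω, Y ω) := hXm.prodMk hYm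
  have : IsProbabilityMeasure (P.map fun ω => (X ω, Y ω)) :=
    Measure.isProbabilityMeasure_map hZ.aemeasurable
  have hXi : Integrable X P := hX.integrable one_le_two
  have hi := integrable_norm_sub_mul hYm (hXi.inner_const (𝕜 := ℝ) (φ a))
    (hXi.inner_const (𝕜 := ℝ) (φ b))
    (integrable_norm_mul_inner hX hY _) (integrable_norm_mul_inner hX hY _)
  set G : (L2I × EuclideanSpace ℝ (Fin q)) × (L2I × EuclideanSpace ℝ (Fin q)) → ℝ :=
    fun p => ‖p.1.2 - p.2.2‖ * (inner ℝ p.1.1 (φ a) * inner ℝ p.2.1 (φ b)) with hG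
  have hGm : Measurable G := by
    have h1 : Measurable fun p : (L2I × EuclideanSpace ℝ (Fin q)) ×
        (L2I × EuclideanSpace ℝ (Fin q)) => (inner ℝ p.1.1 (φ a) : ℝ) :=
      (measurable_inner_fst (φ a)).comp measurable_fst
    have h2 : Measurable fun p : (L2I × EuclideanSpace ℝ (Fin q)) ×
        (L2I × EuclideanSpace ℝ (Fin q)) => (inner ℝ p.2.1 (φ b) : ℝ) :=
      (measurable_inner_fst (φ b)).comp measurable_snd
    exact Measurable.mul (by fun_prop) (h1.mul h2)
  have hmap := Measure.map_prod_map P P hZ hZ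
  have hZZ : Measurable (Prod.map (fun ω => (X ω, Y ω)) fun ω => (X ω, Y ω)) := hZ.prodMap hZ
  have hGi : Integrable G ((P.map fun ω => (X ω, Y ω)).prod (P.map fun ω => (X ω, Y ω))) := by
    rw [hmap, integrable_map_measure hGm.aestronglyMeasurable hZZ.aemeasurable]
    exact hi
  rw [← integral_prod_eq_integral_mul_condMean hGi, hmap,
    integral_map hZZ.aemeasurable hGm.aestronglyMeasurable]
  rfl

theorem map_sample_eq_pi {α : Type*} [MeasurableSpace α] {n : ℕ} {Z : Ω → α}
    {Zs : Fin n → Ω → α} (hi : iIndepFun Zs P) (hd : ∀ k, IdentDistrib (Zs k) Z P P) :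
    P.map (fun ω k => Zs k ω) = Measure.pi fun _ : Fin n => P.map Z := by
  rw [(iIndepFun_iff_map_fun_eq_pi_map fun k => (hd k).aemeasurable_fst).1 hi]
  congr 1
  funext k
  exact (hd k).map_eq

/-- With high probability all entries of the sample operator are close to their limits. -/
theorem exists_event_abs_vStat_sub_le {s σ : ℝ} (hs : 0 < s) (hσ : 0 < σ)
    (hXm : Measurable X) (hYm : Measurable Y) (hX : MemLp X 2 P) (hY : MemLp Y 2 P)
    (φ : ℕ → L2I)
    (hφ : ∀ j, ∫⁻ ω, ENNReal.ofReal (Real.exp (2 * s * inner ℝ (X ω) (φ j) ^ 2)) ∂P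
      ≤ ENNReal.ofReal σ)
    (hYe : ∫⁻ ω, ENNReal.ofReal (Real.exp (2 * s * ‖Y ω‖ ^ 2)) ∂P ≤ ENNReal.ofReal σ)
    {n : ℕ} (hn : 0 < n) (m : ℕ) {Xs : Fin n → Ω → L2I}
    {Ys : Fin n → Ω → EuclideanSpace ℝ (Fin q)}
    (hi : iIndepFun (fun k ω => (Xs k ω, Ys k ω)) P)
    (hd : ∀ k, IdentDistrib (fun ω => (Xs k ω, Ys k ω)) (fun ω => (X ω, Y ω)) P P)
    {L : ℝ} (hL1 : 1 ≤ L) (hLc : 2 * expBound s σ ≤ L) :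
    ∃ A : Set Ω, MeasurableSet A ∧
      1 - (4 + σ) * (m : ℝ) ^ 2 * n * Real.exp (-L) ≤ P.real A ∧
      ∀ ω ∈ A, ∀ a < m, ∀ b < m,
        |(1 / (n : ℝ) ^ 2) * ∑ j, ∑ k, ‖Ys j ω - Ys k ω‖ *
          (inner ℝ (Xs j ω) (φ a) * inner ℝ (Xs k ω) (φ b)) - mddEntry P X Y φ a b| ≤
        devBound s σ * L ^ 2 / √n := by
  have hZ : Measurable fun ω => (X ω, Y ω) := hXm.prodMk hYm
  set μ := P.map fun ω => (X ω, Y ω) with hμ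
  have hμp : IsProbabilityMeasure μ := Measure.isProbabilityMeasure_map hZ.aemeasurable
  have hcoord : ∀ j, HasExpSq μ s σ fun z => inner ℝ z.1 (φ j) := fun j =>
    HasExpSq.of_lintegral hZ (measurable_inner_fst _) hσ.le (hφ j)
  have hnorm : HasExpSq μ s σ fun z => ‖z.2‖ :=
    HasExpSq.of_lintegral hZ measurable_snd.norm hσ.le hYe
  set Zs : Ω → Fin n → L2I × EuclideanSpace ℝ (Fin q) := fun ω k => (Xs k ω, Ys k ω) with hZs
  have hlaw : P.map Zs = Measure.pi fun _ : Fin n => μ := map_sample_eq_pi hi hd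
  have hZsm : AEMeasurable Zs P := aemeasurable_pi_lambda _ fun k => (hd k).aemeasurable_fst
  set B : ℕ → ℕ → Set (Fin n → L2I × EuclideanSpace ℝ (Fin q)) := fun a b =>
    {z | devBound s σ * L ^ 2 / √n <
      |vStat Prod.snd (fun z => inner ℝ z.1 (φ a)) (fun z => inner ℝ z.1 (φ b)) z -
        mddEntry P X Y φ a b|} with hB
  have hBm : ∀ a b, (Measure.pi fun _ : Fin n => μ) (B a b) ≤
      ENNReal.ofReal ((4 + σ) * n * Real.exp (-L)) := fun a b => by
    have := measure_pi_abs_vStat_sub_gt_le hs hσ measurable_snd hnorm (hcoord a) (hcoord b) hn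
      hL1 hLc
    rwa [← mddEntry_eq_integral_condMean hXm hYm hX hY φ a b] at this
  set U := ⋃ a ∈ Finset.range m, ⋃ b ∈ Finset.range m, B a b with hU
  have hUm : P (Zs ⁻¹' U) ≤ ENNReal.ofReal ((4 + σ) * (m : ℝ) ^ 2 * n * Real.exp (-L)) := by
    refine (Measure.le_map_apply hZsm U).trans ?_
    rw [hlaw]
    calc _ ≤ ∑ a ∈ Finset.range m, ∑ b ∈ Finset.range m,
          ENNReal.ofReal ((4 + σ) * n * Real.exp (-L)) :=
          (measure_biUnion_finset_le _ _).trans (Finset.sum_le_sum fun a _ =>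
            (measure_biUnion_finset_le _ _).trans (Finset.sum_le_sum fun b _ => hBm a b))
      _ = ENNReal.ofReal (((m * m : ℕ) : ℝ) * ((4 + σ) * n * Real.exp (-L))) := by
          rw [ENNReal.ofReal_mul (p := ((m * m : ℕ) : ℝ)) (by positivity),
            ENNReal.ofReal_natCast]
          simp [mul_assoc]
      _ = _ := by
          congr 1
          push_cast
          ring
  -- The sample is only almost everywhere measurable, so the bad event is replaced by a measurable
  -- hull of the same measure.
  refine ⟨(toMeasurable P (Zs ⁻¹' U))ᶜ, (measurableSet_toMeasurable _ _).compl, ?_, ?_⟩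
  · rw [probReal_compl_eq_one_sub (measurableSet_toMeasurable _ _)]
    have : P.real (toMeasurable P (Zs ⁻¹' U)) ≤ (4 + σ) * (m : ℝ) ^ 2 * n * Real.exp (-L) := by
      rw [measureReal_def, measure_toMeasurable]
      exact ENNReal.toReal_le_of_le_ofReal (by positivity) hUm
    linarith
  · intro ω hω a ha b hb
    have h1 : Zs ω ∉ U := fun h => hω (subset_toMeasurable P _ h)
    simp only [hU, Set.mem_iUnion, Finset.mem_range, not_exists] at h1
    exact not_lt.1 (h1 a ha b hb)

/-- Here `D₂ = 1 / (1 + A)`. Since `L (1 + A) ≥ 1`, the exponent 2 may be raised to `5/2`, and `A ≤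
(1 + A)²` absorbs the deviation constant; strictness comes from `2 < 24`. -/
theorem two_mul_devBound_lt {A L n m : ℝ} (hA : 0 < A) (hL : 1 ≤ L) (hn : 0 < n) (hm : 0 < m) :
    2 * (m * (A * L ^ 2 / √n)) < (L / (1 / (1 + A))) ^ (5 / 2 : ℝ) * (24 * m / √n) := by
  have h1 : 1 ≤ L * (1 + A) := by nlinarith
  have h2 : A * L ^ 2 ≤ (L / (1 / (1 + A))) ^ (5 / 2 : ℝ) := by
    rw [div_div_eq_mul_div, div_one]
    calc A * L ^ 2 ≤ (L * (1 + A)) ^ 2 := by nlinarith [sq_nonneg L, sq_nonneg A]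
      _ = (L * (1 + A)) ^ (2 : ℝ) := by norm_cast
      _ ≤ (L * (1 + A)) ^ (5 / 2 : ℝ) := Real.rpow_le_rpow_of_exponent_le h1 (by norm_num)
  have hpos : 0 < A * L ^ 2 := by positivity
  have hmn : 0 < m / √n := by positivity
  calc 2 * (m * (A * L ^ 2 / √n)) = 2 * (A * L ^ 2) * (m / √n) := by ring
    _ < 24 * (A * L ^ 2) * (m / √n) := by gcongr; norm_num
    _ ≤ 24 * (L / (1 / (1 + A))) ^ (5 / 2 : ℝ) * (m / √n) := by gcongr
    _ = _ := by ring

theorem momentBound_pos {s σ : ℝ} (hs : 0 < s) (hσ : 0 < σ) : 0 < momentBound s σ := by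
  unfold momentBound
  positivity

theorem expBound_pos {s σ : ℝ} (hσ : 0 < σ) : 0 < expBound s σ := by
  unfold expBound
  positivity

theorem devBound_pos {s σ : ℝ} (hs : 0 < s) (hσ : 0 < σ) : 0 < devBound s σ := by
  have := momentBound_pos hs hσ
  unfold devBound
  positivity

end Assembly

end FSFIR

end

theorem mainTheorem6 :
    ∀ σ₁ : ℝ, 0 < σ₁ → ∃ D₁ : ℝ, 0 < D₁ ∧
    ∀ σ₀ : ℝ, 0 < σ₀ → ∃ D₂ : ℝ, 0 < D₂ ∧
    ∀ γ ∈ Set.Ioo (0 : ℝ) (1 / 2), ∃ D₀ : ℝ, 0 < D₀ ∧ ∃ n₀ : ℕ, 0 < n₀ ∧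
    ∀ (Ω : Type*) [MeasurableSpace Ω] (P : Measure Ω) [IsProbabilityMeasure P]
      (q : ℕ) (X : Ω → FSFIR.L2I) (Y : Ω → EuclideanSpace ℝ (Fin q))
      (φ : HilbertBasis ℕ ℝ FSFIR.L2I) (eig : ℕ → ℝ) (d : ℕ),
      Measurable X → Measurable Y →
      -- centred predictor, finite second moments
      ∫ ω, X ω ∂P = 0 →
      MemLp X 2 P → MemLp Y 2 P →
      -- eigenvalues in descending order and eigenfunctions of the covariance operator
      Antitone eig → (∀ j, FSFIR.covOp P X (φ j) = eig j • φ j) →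
      -- the rank of `var(E[X | Y])` is at most `d`
      LinearMap.rank (FSFIR.covOp P
        (P[X | MeasurableSpace.comap Y inferInstance])).toLinearMap ≤ (d : Cardinal) →
      -- uniform sub-Gaussianity
      (∀ j, ∫⁻ ω, ENNReal.ofReal (Real.exp (2 * σ₀ * inner ℝ (X ω) (φ j) ^ 2)) ∂P
        ≤ ENNReal.ofReal σ₁) →
      ∫⁻ ω, ENNReal.ofReal (Real.exp (2 * σ₀ * ‖Y ω‖ ^ 2)) ∂P ≤ ENNReal.ofReal σ₁ →
    ∀ n : ℕ, n₀ ≤ n → ∀ m : ℕ, 0 < m →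
    -- an i.i.d. sample of size `n` from the law of `(X, Y)`
    ∀ (Xs : Fin n → Ω → FSFIR.L2I) (Ys : Fin n → Ω → EuclideanSpace ℝ (Fin q)),
      iIndepFun (fun k ω => (Xs k ω, Ys k ω)) P →
      (∀ k, IdentDistrib (fun ω => (Xs k ω, Ys k ω)) (fun ω => (X ω, Y ω)) P P) →
    ∀ C ∈ Set.Ioc
      (D₀ * (n : ℝ) ^ (2 * γ / 5) - Real.log (D₁ * (m : ℝ) ^ 2 * n))
      (D₂ * (n : ℝ) ^ (1 / 5 : ℝ) - Real.log (D₁ * (m : ℝ) ^ 2 * n)),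
    ∃ A : Set Ω, MeasurableSet A ∧ 1 - Real.exp (-C) ≤ P.real A ∧
      ∀ ω ∈ A,
        (∃ S : FSFIR.L2I →L[ℝ] FSFIR.L2I, FSFIR.IsTopEigenPart d
          (FSFIR.sampleMDDO (fun k => FSFIR.truncProj φ m (Xs k ω)) (fun k => Ys k ω)) S) ∧
        ∀ S : FSFIR.L2I →L[ℝ] FSFIR.L2I, FSFIR.IsTopEigenPart d
          (FSFIR.sampleMDDO (fun k => FSFIR.truncProj φ m (Xs k ω)) (fun k => Ys k ω)) S →
        ‖S - FSFIR.mddo P (fun ω' => FSFIR.truncProj φ m (X ω')) Y‖ <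
          ((C + Real.log (D₁ * (m : ℝ) ^ 2 * n)) / D₂) ^ (5 / 2 : ℝ)
            * (24 * m / Real.sqrt n) := by
  intro σ₁ hσ₁
  -- `D₁` is the constant of the union bound, so that the failure probability at level `L` is
  -- exactly `exp (-C)`.
  refine ⟨4 + σ₁, by positivity, fun σ₀ hσ₀ => ?_⟩
  have hA := FSFIR.devBound_pos hσ₀ hσ₁
  have hc := FSFIR.expBound_pos (s := σ₀) hσ₁
  refine ⟨1 / (1 + FSFIR.devBound σ₀ σ₁), by positivity, fun γ hγ => ?_⟩
  -- As `n ^ (2γ/5) ≥ 1`, this `D₀` ensures both `L ≥ 1` and `L ≥ 2 * expBound`, which the deviation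
  -- bound needs.
  refine ⟨1 + 2 * FSFIR.expBound σ₀ σ₁, by positivity, 1, one_pos, ?_⟩
  intro Ω _ P _ q X Y φ eig d hXm hYm hX0 hX hY _ _ hrank hexpX hexpY n hn m hm Xs Ys hind hid C hC
  have hn' : (1 : ℝ) ≤ n := Nat.one_le_cast.2 hn
  have hm' : (0 : ℝ) < m := Nat.cast_pos.2 hm
  set L := C + Real.log ((4 + σ₁) * (m : ℝ) ^ 2 * n) with hLdef
  have hL : 1 + 2 * FSFIR.expBound σ₀ σ₁ ≤ L := by
    have h1 := hC.1
    have h2 : 1 ≤ (n : ℝ) ^ (2 * γ / 5) := Real.one_le_rpow hn' (by linarith [hγ.1])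
    have h3 : 1 + 2 * FSFIR.expBound σ₀ σ₁ ≤
        (1 + 2 * FSFIR.expBound σ₀ σ₁) * (n : ℝ) ^ (2 * γ / 5) :=
      le_mul_of_one_le_right (by positivity) h2
    linarith
  obtain ⟨A, hAm, hAP, hAω⟩ := FSFIR.exists_event_abs_vStat_sub_le hσ₀ hσ₁ hXm hYm hX hY φ hexpX
    hexpY hn m hind hid (L := L) (by linarith) (by linarith)
  have hexp : (4 + σ₁) * (m : ℝ) ^ 2 * n * Real.exp (-L) = Real.exp (-C) := by
    have hpos : 0 < (4 + σ₁) * (m : ℝ) ^ 2 * n := by positivity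
    rw [hLdef, neg_add, Real.exp_add, Real.exp_neg (Real.log _), Real.exp_log hpos]
    field_simp
  rw [hexp] at hAP
  refine ⟨A, hAm, hAP, fun ω hω => ?_⟩
  rw [FSFIR.sampleMDDO_truncProj, FSFIR.mddo_truncProj hX hX0 hYm hY]
  set V : ℕ → ℕ → ℝ := fun a b => (1 / (n : ℝ) ^ 2) * ∑ j, ∑ k, ‖Ys j ω - Ys k ω‖ *
    (inner ℝ (Xs j ω) (φ a) * inner ℝ (Xs k ω) (φ b)) with hV
  have hsymm : ∀ a b, V a b = V b a := fun a b => by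
    simp only [hV]
    rw [Finset.sum_comm]
    refine congrArg _ (Finset.sum_congr rfl fun j _ => Finset.sum_congr rfl fun k _ => ?_)
    rw [norm_sub_rev, mul_comm (inner ℝ (Xs k ω) (φ a))]
  have hT := FSFIR.coordOp_isSymmetric φ m hsymm
  refine ⟨FSFIR.exists_isTopEigenPart φ.orthonormal hT (FSFIR.coordOp_mem_span φ m V) d,
    fun S hS => ?_⟩
  refine (hS.norm_sub_le hT (FSFIR.inner_coordOp_mddEntry_self_nonneg hX hX0 hYm hY φ m)
    ((FSFIR.rank_coordOp_mddEntry_le hX hX0 hYm hY φ m).trans hrank)).trans_lt ?_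
  rw [FSFIR.coordOp_sub]
  refine (mul_le_mul_of_nonneg_left (FSFIR.norm_coordOp_le φ.orthonormal m
    (ε := FSFIR.devBound σ₀ σ₁ * L ^ 2 / √n) (by positivity) (hAω ω hω)) zero_le_two).trans_lt ?_
  exact FSFIR.two_mul_devBound_lt hA (by linarith) (by linarith) hm'
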